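/- Let $q=3^r$ with $r\ge 1$, and let $\mathbb F_q\supseteq\mathbb F_3$ be the field with $q$ elements. **Notation.** In block form (block sizes $n,n,1$), let $$Q=Q(2n+1,q)=\left\{\begin{bmatrix}A&0&0\\0&{}^tA^{-1}&0\\0&0&1\end{bmatrix}\begin{bmatrix}1_n&B&-{}^th\\0&1_n&0\\0&h&1\end{bmatrix}\ :\ A\in GL(n,q),\ B\in\mathbb F_q^{n\times n},\ h\in\mathbb F_q^{1\times n},\ B+{}^tB+{}^thh=0\right\},$$ $\rho=\operatorname{diag}(1_n,1_n,-1)$, and, for $0\le s\le n$, $$\sigma_s=\begin{bmatrix}0&0&1_s&0&0\\0&1_{n-s}&0&0&0\\1_s&0&0&0&0\\0&0&0&1_{n-s}&0\\0&0&0&0&1\end{bmatrix}.$$ Put $DC_1^-(n,q)=Q\sigma_{n-1}Q$ and $DC_2^-(n,q)=\rho Q\sigma_{n-1}Q$ for odd $n\ge1$; $DC_1^+(n,q)=Q\sigma_{n-2}Q$ and $DC_2^+(n,q)=\rho Q\sigma_{n-2}Q$ for even $n\ge2$. Let $\left[{n\atop s}\right]_q=\prod_{j=0}^{s-1}\frac{q^{n-j}-1}{q^{s-j}-1}$.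 For odd $n$ let $$A^-=q^{\frac14(5n^2-1)}\left[{n\atop 1}\right]_q\prod_{j=1}^{(n-1)/2}(q^{2j-1}-1),\qquad B^-=q^{\frac14(n-1)^2}(q^n-1)\prod_{j=1}^{(n-1)/2}(q^{2j}-1),$$ and for even $n\ge 2$ let $$A^+=q^{\frac14(5n^2-2n)}\left[{n\atop 2}\right]_q\prod_{j=1}^{(n-2)/2}(q^{2j-1}-1),\qquad B^+=q^{\frac14(n-2)^2}(q^n-1)(q^{n-1}-1)\prod_{j=1}^{(n-2)/2}(q^{2j}-1).$$ For $m\ge1$ and $\beta\in\mathbb F_q$ let $\delta(m,q;\beta)$ be the number of $(\alpha_1,\dots,\alpha_m)\in(\mathbb F_q^*)^m$ with $\alpha_1+\alpha_1^{-1}+\cdots+\alpha_m+\alpha_m^{-1}=\beta$. For nonnegative integers let $\binom{c}{a,b}=\frac{c!}{a!\,b!\,(c-a-b)!}$ if $a+b\le c$, and $\binom{c}{a,b}=0$ if $a+b>c$. For $D=DC_i^{\mp}(n,q)$ ($i=1,2$) let $N_i^\mp(n,q)=|D|$, fix an ordering $g_1,\dots,g_N$ of the elements of $D$ ($N=N_i^\mp(n,q)$),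 and let $$C(D)=\Big\{u\in\mathbb F_3^N:\ \sum_{k=1}^N u_k\operatorname{Tr}(g_k)=0\ \text{in}\ \mathbb F_q\Big\}.$$ Let $C_{i,j}^\mp(n,q)$ be the number of words of Hamming weight $j$ in $C(DC_i^\mp(n,q))$. **Theorem.** One has $N_i^\mp(n,q)=A^\mp B^\mp$ for $i=1,2$. In each of the formulas below the unlabelled sum is over all families of nonnegative integers $\{\nu_\beta\}_{\beta\in\mathbb F_q}$, $\{\mu_\beta\}_{\beta\in\mathbb F_q}$ with $$\sum_{\beta}\nu_\beta+\sum_{\beta}\mu_\beta=j\quad\text{and}\quad\sum_{\beta}\nu_\beta\,\beta=\sum_{\beta}\mu_\beta\,\beta\ \text{ in }\mathbb F_q;$$ all upper entries of the multinomial coefficients are nonnegative integers; and, for every $\beta\in\mathbb F_q$, the upper entry belonging to $\beta$ (in (1) and (2): in the first expression) equals the number of $w\in DC_i^{\mp}(n,q)$ with $\operatorname{Tr}w=\beta$. (1) For $n\ge1$ odd and $j=0,\dots,N_1^-(n,q)$, $$C_{1,j}^-(n,q)=\sum\prod_{\beta\in\mathbb F_q}\binom{q^{-1}A^-(B^-+q\,\delta(1,q;\beta-1)-q+1)}{\nu_\beta,\mu_\beta}$$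 $$=\sum\binom{q^{-1}A^-(B^-+1)}{\nu_0,\mu_0}\binom{q^{-1}A^-(B^-+1)}{\nu_2,\mu_2}\prod_{\beta^2-2\beta\ne0\text{ square}}\binom{q^{-1}A^-(B^-+q+1)}{\nu_\beta,\mu_\beta}\prod_{\beta^2-2\beta\text{ nonsquare}}\binom{q^{-1}A^-(B^--q+1)}{\nu_\beta,\mu_\beta}.$$ (2) For $n\ge1$ odd and $j=0,\dots,N_2^-(n,q)$, $$C_{2,j}^-(n,q)=\sum\prod_{\beta\in\mathbb F_q}\binom{q^{-1}A^-(B^-+q\,\delta(1,q;\beta+1)-q+1)}{\nu_\beta,\mu_\beta}$$ $$=\sum\binom{q^{-1}A^-(B^-+1)}{\nu_0,\mu_0}\binom{q^{-1}A^-(B^-+1)}{\nu_1,\mu_1}\prod_{\beta^2+2\beta\ne0\text{ square}}\binom{q^{-1}A^-(B^-+q+1)}{\nu_\beta,\mu_\beta}\prod_{\beta^2+2\beta\text{ nonsquare}}\binom{q^{-1}A^-(B^--q+1)}{\nu_\beta,\mu_\beta}.$$ (3) For $n\ge2$ even and $j=0,\dots,N_1^+(n,q)$, $$C_{1,j}^+(n,q)=\sum\binom{q^{-1}A^+(B^++q\,\delta(2,q;0)+(q-1)^3)}{\nu_1,\mu_1}\prod_{\beta\ne1}\binom{q^{-1}A^+(B^++q\,\delta(2,q;\beta-1)-2q^2+3q-1)}{\nu_\beta,\mu_\beta}.$$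 (4) For $n\ge2$ even and $j=0,\dots,N_2^+(n,q)$, $$C_{2,j}^+(n,q)=\sum\binom{q^{-1}A^+(B^++q\,\delta(2,q;0)+(q-1)^3)}{\nu_{-1},\mu_{-1}}\prod_{\beta\ne-1}\binom{q^{-1}A^+(B^++q\,\delta(2,q;\beta+1)-2q^2+3q-1)}{\nu_\beta,\mu_\beta}.$$ -/

import Mathlib

open Finset

namespace TernaryDC

/-! ### Matrices of size `2n+1`, in blocks of sizes `n`, `n`, `1` -/

section Matrices

variable (F : Type*) [Field F] (n : ℕ)

/-- The row and column index set of `(2n+1) × (2n+1)` matrices, split as `n + n + 1`. -/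
abbrev Idx (n : ℕ) : Type := (Fin n ⊕ Fin n) ⊕ Unit

/-- Square matrices of size `2n+1` over `F`. -/
abbrev Mat : Type _ := Matrix (Idx n) (Idx n) F

variable {F n}

/-- The block diagonal matrix `diag(A, ᵗA⁻¹, 1)` for `A ∈ GL(n, F)`. -/
def levi (A : GL (Fin n) F) : Mat F n :=
  Matrix.fromBlocks
    (Matrix.fromBlocks (A : Matrix (Fin n) (Fin n) F) 0 0
      (((A⁻¹ : GL (Fin n) F) : Matrix (Fin n) (Fin n) F).transpose)) 0
    0 1

/-- The block matrix with rows `(1, B, -ᵗh)`, `(0, 1, 0)`, `(0, h, 1)`, where `B` is `n × n` and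
`h` is `1 × n`. -/
def unip (B : Matrix (Fin n) (Fin n) F) (h : Matrix Unit (Fin n) F) : Mat F n :=
  Matrix.fromBlocks
    (Matrix.fromBlocks 1 B 0 1) (Matrix.fromRows (-h.transpose) 0)
    (Matrix.fromCols 0 h) 1

variable (F n)

/-- The subgroup `Q(2n+1, q)` of the orthogonal group, as a set of matrices. -/
def Q : Set (Mat F n) :=
  {w | ∃ (A : GL (Fin n) F) (B : Matrix (Fin n) (Fin n) F) (h : Matrix Unit (Fin n) F),
    B + B.transpose + h.transpose * h = 0 ∧ w = levi A * unip B h}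

/-- The matrix `ρ = diag(1_n, 1_n, -1)`. -/
def rho : Mat F n := Matrix.fromBlocks 1 0 0 (-1)

/-- The matrix `σ_r` (for `r ≤ n`): with the first two blocks of size `n` subdivided as
`r + (n - r)`, it interchanges the two subblocks of size `r` and is the identity elsewhere. -/
def sigma (r : ℕ) : Mat F n :=
  let D : Matrix (Fin n) (Fin n) F := Matrix.diagonal fun i => if (i : ℕ) < r then 1 else 0
  let E : Matrix (Fin n) (Fin n) F := Matrix.diagonal fun i => if (i : ℕ) < r then 0 else 1
  Matrix.fromBlocks (Matrix.fromBlocks E D D E) 0 0 1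

/-- The double coset `Q σ_r Q`. -/
def doubleCoset (r : ℕ) : Set (Mat F n) :=
  {w | ∃ x ∈ Q F n, ∃ y ∈ Q F n, w = x * sigma F n r * y}

/-- The set `ρ Q σ_r Q`. -/
def rhoDoubleCoset (r : ℕ) : Set (Mat F n) :=
  {w | ∃ x ∈ Q F n, ∃ y ∈ Q F n, w = rho F n * x * sigma F n r * y}

/-- `DC₁⁻(n, q) = Q σ_{n-1} Q` (used for odd `n`). -/
def dcMinus1 : Set (Mat F n) := doubleCoset F n (n - 1)

/-- `DC₂⁻(n, q) = ρ Q σ_{n-1} Q` (used for odd `n`). -/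
def dcMinus2 : Set (Mat F n) := rhoDoubleCoset F n (n - 1)

/-- `DC₁⁺(n, q) = Q σ_{n-2} Q` (used for even `n ≥ 2`). -/
def dcPlus1 : Set (Mat F n) := doubleCoset F n (n - 2)

/-- `DC₂⁺(n, q) = ρ Q σ_{n-2} Q` (used for even `n ≥ 2`). -/
def dcPlus2 : Set (Mat F n) := rhoDoubleCoset F n (n - 2)

end Matrices

/-! ### The numerical constants -/

/-- The `q`-binomial coefficient `∏_{j < r} (q^{n-j} - 1) / (q^{r-j} - 1)` (for `r ≤ n`). -/
def qBinom (n r q : ℕ) : ℚ :=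
  ∏ j ∈ range r, ((q : ℚ) ^ (n - j) - 1) / ((q : ℚ) ^ (r - j) - 1)

/-- `A⁻(n, q)`, for odd `n`; the division in the exponent is then exact. -/
def Aminus (n q : ℕ) : ℚ :=
  (q : ℚ) ^ ((5 * n ^ 2 - 1) / 4) * qBinom n 1 q
    * ∏ j ∈ Icc 1 ((n - 1) / 2), ((q : ℚ) ^ (2 * j - 1) - 1)

/-- `B⁻(n, q)`, for odd `n`; the division in the exponent is then exact. -/
def Bminus (n q : ℕ) : ℚ :=
  (q : ℚ) ^ ((n - 1) ^ 2 / 4) * ((q : ℚ) ^ n - 1)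
    * ∏ j ∈ Icc 1 ((n - 1) / 2), ((q : ℚ) ^ (2 * j) - 1)

/-- `A⁺(n, q)`, for even `n ≥ 2`; the division in the exponent is then exact. -/
def Aplus (n q : ℕ) : ℚ :=
  (q : ℚ) ^ ((5 * n ^ 2 - 2 * n) / 4) * qBinom n 2 q
    * ∏ j ∈ Icc 1 ((n - 2) / 2), ((q : ℚ) ^ (2 * j - 1) - 1)

/-- `B⁺(n, q)`, for even `n ≥ 2`; the division in the exponent is then exact. -/
def Bplus (n q : ℕ) : ℚ :=
  (q : ℚ) ^ ((n - 2) ^ 2 / 4) * ((q : ℚ) ^ n - 1) * ((q : ℚ) ^ (n - 1) - 1)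
    * ∏ j ∈ Icc 1 ((n - 2) / 2), ((q : ℚ) ^ (2 * j) - 1)

/-- `δ(m, q; β)`: the number of `(α₁, …, α_m) ∈ (F^*)^m` with
`α₁ + α₁⁻¹ + ⋯ + α_m + α_m⁻¹ = β`. -/
noncomputable def delta {F : Type*} [Field F] (m : ℕ) (β : F) : ℕ :=
  Nat.card {α : Fin m → Fˣ // ∑ i, ((α i : F) + (α i : F)⁻¹) = β}

/-- The multinomial coefficient `c! / (a! b! (c - a - b)!)` if `a + b ≤ c`, and `0` otherwise. -/
def trinom (c a b : ℕ) : ℕ :=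
  if a + b ≤ c then c.factorial / (a.factorial * b.factorial * (c - a - b).factorial) else 0

/-! ### The codes and their weight distributions -/

/-- The ternary linear code of all `u ∈ 𝔽₃^N` with `u · v = 0`, for a vector `v ∈ F^N`, where `F`
is a field containing `𝔽₃` and the dot product is taken in `F^N`. -/
def code {F : Type*} [Field F] [Algebra (ZMod 3) F] {N : ℕ} (v : Fin N → F) :
    Submodule (ZMod 3) (Fin N → ZMod 3) where
  carrier := {u | ∑ k, algebraMap (ZMod 3) F (u k) * v k = 0}
  zero_mem' := by simp
  add_mem' := by
    intro a b ha hb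
    simp only [Set.mem_ofPred_eq] at ha hb ⊢
    simp [add_mul, Finset.sum_add_distrib, ha, hb]
  smul_mem' := by
    intro c a ha
    simp only [Set.mem_ofPred_eq] at ha ⊢
    simp [mul_assoc, ← Finset.mul_sum, ha]

/-- The ternary code `C(D)` of a set `D` of matrices, for a fixed ordering `g` of its elements:
the words orthogonal to the vector `(Tr g₁, …, Tr g_N)`. -/
noncomputable def dcCode {F : Type*} [Field F] [Algebra (ZMod 3) F] {n : ℕ} {D : Set (Mat F n)}
    (g : Fin D.ncard ≃ D) : Submodule (ZMod 3) (Fin D.ncard → ZMod 3) :=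
  code fun k => (g k : Mat F n).trace

/-- The number of codewords of Hamming weight `j` in a ternary code `C`. -/
noncomputable def weightDist {N : ℕ} (C : Submodule (ZMod 3) (Fin N → ZMod 3)) (j : ℕ) : ℕ :=
  {u : Fin N → ZMod 3 | u ∈ C ∧ hammingNorm u = j}.ncard

/-- The finite set of all pairs `(ν, μ)` of families of nonnegative integers indexed by `F` with
`∑ ν_β + ∑ μ_β = j` and `∑ ν_β β = ∑ μ_β β` in `F`. -/
def pairs (F : Type*) [Field F] [Fintype F] [DecidableEq F] (j : ℕ) :
    Finset ((F → ℕ) × (F → ℕ)) :=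
  ((Fintype.piFinset fun _ : F => range (j + 1)) ×ˢ
    (Fintype.piFinset fun _ : F => range (j + 1))).filter fun p =>
      ∑ β, p.1 β + ∑ β, p.2 β = j ∧ ∑ β, (p.1 β : F) * β = ∑ β, (p.2 β : F) * β

/-- The bounds `ν_β, μ_β ≤ j` built into `pairs` are automatic. -/
theorem mem_pairs {F : Type*} [Field F] [Fintype F] [DecidableEq F] {j : ℕ}
    {p : (F → ℕ) × (F → ℕ)} :
    p ∈ pairs F j ↔
      ∑ β, p.1 β + ∑ β, p.2 β = j ∧ ∑ β, (p.1 β : F) * β = ∑ β, (p.2 β : F) * β := by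
  simp only [pairs, mem_filter, mem_product, Fintype.mem_piFinset, mem_range, and_iff_right_iff_imp]
  rintro ⟨h, -⟩
  refine ⟨fun a => ?_, fun a => ?_⟩
  · have := single_le_sum (f := p.1) (fun i _ => Nat.zero_le _) (mem_univ a)
    omega
  · have := single_le_sum (f := p.2) (fun i _ => Nat.zero_le _) (mem_univ a)
    omega

end TernaryDC

open TernaryDC

namespace TernaryDC

/-! ### Weight distribution of a ternary code with one parity check over `F` -/

/-! A ternary word is determined, up to its positions, by how many coordinates with trace `β` carry
a 1 (`ν_β`) and how many carry a 2 (`μ_β`). Since 2 = -1, both the parity check and the weight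
depend only on these numbers, and each family `(ν, μ)` is realised by a product of trinomials. So
`weightDist_dcCode` reduces everything to counting the elements of given trace in the double coset.

Trace is a class function. Hence `ncard_doubleCoset_mul` replaces the count on `QσQ` by a count on
`Qσ`, up to the index of `Q ∩ σQσ`. In characteristic 3 the group `Q` is parametrised freely by an
invertible `A`, a skew `K` and a vector `v`, with `B = K + ᵗvv`. With `P` the projection to the
first `r` coordinates, the trace of `xσ_r` is affine in `K` with linear part `Tr(PAK)`. If `PA` is
not symmetric, this form is nonzero on skew matrices and the trace is equidistributed. If `PA` is
symmetric, then `A` is block lower triangular with symmetric corner `S`, and the trace is `Tr T + Tr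
T⁻¹ + v S ᵗv + 1`, with `T` the lower diagonal block and `v` cut to its head.

The parity of `r` now enters: `r` is even in all cases, and then a nonzero vector is isotropic for
exactly one in `q` of the invertible symmetric matrices (`card_mul_isoCount`). So the value `v S ᵗv`
deviates from uniform only through `v = 0` (`quadCount_of_even`), and the deviation of the trace
count is a multiple of `q·#{T : Tr T + Tr T⁻¹ = β - 1} - |GL(k)|`, where `k = n - r` is 1 or 2. For
these `k` the solutions `T` are counted by `δ(k, q; ·)` (`glTraceCount_one`, `glTraceCount_two`).

The constants come from `|QσQ| = |Q|²/|Q ∩ σQσ|` and the orders of the groups involved. Since `ρ` is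
minus an element of `Q`, the sets with `ρ` are the negatives of the double cosets, which replaces
`β` by `-β`. For odd `n` the equation `x + x⁻¹ = γ` is a quadratic of discriminant `γ² - 1`, which
gives the split into square classes. -/

theorem choose_mul_choose_eq_trinom (c a b : ℕ) :
    c.choose a * (c - a).choose b = trinom c a b := by
  unfold trinom
  split_ifs with h
  · rw [Nat.choose_eq_factorial_div_factorial (by omega : a ≤ c),
      Nat.choose_eq_factorial_div_factorial (by omega : b ≤ c - a),
      Nat.div_mul_div_comm (Nat.factorial_mul_factorial_dvd_factorial (by omega))
        (Nat.factorial_mul_factorial_dvd_factorial (by omega))]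
    have h1 : c.factorial * (c - a).factorial = (c - a).factorial * c.factorial := mul_comm _ _
    have h2 : a.factorial * (c - a).factorial * (b.factorial * (c - a - b).factorial)
        = (c - a).factorial * (a.factorial * b.factorial * (c - a - b).factorial) := by ring
    rw [h1, h2, Nat.mul_div_mul_left _ _ (Nat.factorial_pos _)]
  · by_cases ha : a ≤ c
    · rw [Nat.choose_eq_zero_of_lt (by omega : c - a < b), mul_zero]
    · rw [Nat.choose_eq_zero_of_lt (by omega), zero_mul]

/-- A word amounts to the pair of disjoint sets where it equals 1 and where it equals 2. -/
theorem card_ternary_words {X : Type*} [Fintype X] [DecidableEq X] (a b : ℕ) :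
    #{u : X → ZMod 3 | #{x | u x = 1} = a ∧ #{x | u x = 2} = b} =
      trinom (Fintype.card X) a b := by
  have key : #((powersetCard a (univ : Finset X)).sigma fun S => powersetCard b Sᶜ) =
      trinom (Fintype.card X) a b := by
    rw [card_sigma, ← choose_mul_choose_eq_trinom]
    rw [sum_congr rfl (g := fun _ => (Fintype.card X - a).choose b)]
    · simp
    · intro S hS
      rw [card_powersetCard, card_compl, (mem_powersetCard.1 hS).2]
  rw [← key]
  refine card_nbij' (fun u => ⟨({x | u x = 1} : Finset X), ({x | u x = 2} : Finset X)⟩)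
    (fun p x => if x ∈ p.1 then 1 else if x ∈ p.2 then 2 else 0) ?_ ?_ ?_ ?_
  · intro u hu
    simp only [coe_filter, mem_univ, true_and, Set.mem_ofPred_eq] at hu
    simp only [mem_coe, mem_sigma, mem_powersetCard, subset_univ, true_and]
    refine ⟨hu.1, fun x hx => ?_, hu.2⟩
    simp only [mem_filter, mem_univ, true_and, mem_compl] at hx ⊢
    rw [hx]; decide
  · rintro ⟨S, T⟩ hp
    simp only [mem_coe, mem_sigma, mem_powersetCard, subset_univ, true_and] at hp
    obtain ⟨hS, hT, hb⟩ := hp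
    simp only [coe_filter, mem_univ, true_and, Set.mem_ofPred_eq]
    constructor
    · rw [← hS]; congr 1; ext x
      simp only [mem_filter, mem_univ, true_and]
      split_ifs with h1 h2
      · simpa using h1
      · simp only [h1, iff_false]; decide
      · simp only [h1, iff_false]; decide
    · rw [← hb]; congr 1; ext x
      simp only [mem_filter, mem_univ, true_and]
      split_ifs with h1 h2
      · have : x ∉ T := fun hx => by simpa [h1] using hT hx
        simp only [this, iff_false]; decide
      · simpa using h2
      · simp only [h2, iff_false]; decide
  · intro u hu
    funext x
    simp only [mem_filter, mem_univ, true_and]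
    have : ∀ t : ZMod 3, (if t = 1 then 1 else if t = 2 then 2 else 0) = t := by decide
    exact this (u x)
  · rintro ⟨S, T⟩ hp
    simp only [mem_coe, mem_sigma, mem_powersetCard, subset_univ, true_and] at hp
    obtain ⟨hS, hT, hb⟩ := hp
    have h1 : ({x | (if x ∈ S then (1 : ZMod 3) else if x ∈ T then 2 else 0) = 1} : Finset X)
        = S := by
      ext x
      simp only [mem_filter, mem_univ, true_and]
      split_ifs with h1 h2
      · simpa using h1
      · simp only [h1, iff_false]; decide
      · simp only [h1, iff_false]; decide
    have h2 : ({x | (if x ∈ S then (1 : ZMod 3) else if x ∈ T then 2 else 0) = 2} : Finset X)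
        = T := by
      ext x
      simp only [mem_filter, mem_univ, true_and]
      split_ifs with h1 h2
      · have : x ∉ T := fun hx => by simpa [h1] using hT hx
        simp only [this, iff_false]; decide
      · simpa using h2
      · simp only [h2, iff_false]; decide
    simp only [h1, h2]

/-- The fibres of `v` partition the coordinates, so a word is an independent choice of a word on
each fibre. -/
theorem card_ternary_words_of_type {F : Type*} [Fintype F] [DecidableEq F] {N : ℕ}
    (v : Fin N → F) (a b : F → ℕ) :
    #{u : Fin N → ZMod 3 | ∀ β, #{k | v k = β ∧ u k = 1} = a β ∧ #{k | v k = β ∧ u k = 2} = b β} =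
      ∏ β, trinom #{k | v k = β} (a β) (b β) := by
  let e : (Fin N → ZMod 3) ≃ (∀ β, {k // v k = β} → ZMod 3) :=
    ((Equiv.sigmaFiberEquiv v).symm.arrowCongr (Equiv.refl _)).trans
      (Equiv.piCurry fun _ _ => ZMod 3)
  have he : ∀ u β (k : {k // v k = β}), e u β k = u k := fun _ _ _ => rfl
  have hcard : ∀ (u : Fin N → ZMod 3) (β : F) (t : ZMod 3),
      #{k | v k = β ∧ u k = t} = #{k : {k // v k = β} | e u β k = t} := by
    intro u β t
    rw [← card_map (Function.Embedding.subtype _)]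
    congr 1
    ext k
    simp [he, and_comm]
  have h2 : ({u : Fin N → ZMod 3 | ∀ β, #{k | v k = β ∧ u k = 1} = a β ∧
      #{k | v k = β ∧ u k = 2} = b β} : Finset _).card =
      (Fintype.piFinset fun β => ({w : {k // v k = β} → ZMod 3 |
        #{x | w x = 1} = a β ∧ #{x | w x = 2} = b β} : Finset _)).card := by
    refine card_nbij' e e.symm ?_ ?_ ?_ ?_
    · intro u hu
      simpa [hcard] using hu
    · intro w hw
      simpa [hcard] using hw
    · intro u _; simp
    · intro w _; simp
  rw [h2, Fintype.card_piFinset]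
  refine prod_congr rfl fun β _ => ?_
  rw [card_ternary_words, Fintype.card_subtype]

theorem zmod_three_algebraMap {F : Type*} [Field F] [Algebra (ZMod 3) F] (t : ZMod 3) :
    algebraMap (ZMod 3) F t = (if t = 1 then 1 else 0) - (if t = 2 then 1 else 0) := by
  have h : ∀ t : ZMod 3, t = (if t = 1 then 1 else 0) - (if t = 2 then 1 else 0) := by decide
  conv_lhs => rw [h t]
  rw [map_sub]
  split_ifs <;> simp

/-- The weight distribution of the code with parity check vector `v`, in terms of the numbers of
coordinates where `v` takes each of its values. -/
theorem weightDist_code {F : Type*} [Field F] [Fintype F] [DecidableEq F] [Algebra (ZMod 3) F]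
    {N : ℕ} (v : Fin N → F) (j : ℕ) :
    weightDist (code v) j = ∑ p ∈ pairs F j, ∏ β, trinom #{k | v k = β} (p.1 β) (p.2 β) := by
  classical
  -- The type of a word: membership in the code and weight both factor through it.
  let ty : (Fin N → ZMod 3) → (F → ℕ) × (F → ℕ) := fun u =>
    (fun β => #{k | v k = β ∧ u k = 1}, fun β => #{k | v k = β ∧ u k = 2})
  have hmem : ∀ u : Fin N → ZMod 3, (u ∈ code v ∧ hammingNorm u = j) ↔ ty u ∈ pairs F j := by
    intro u
    rw [mem_pairs, and_comm]
    have h1 : hammingNorm u = ∑ β, (ty u).1 β + ∑ β, (ty u).2 β := by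
      have hf : ∀ t : ZMod 3, ∑ β, #{k | v k = β ∧ u k = t} = #{k | u k = t} := by
        intro t
        rw [card_eq_sum_card_fiberwise (f := v) (t := univ) (by simp)]
        refine sum_congr rfl fun β _ => ?_
        rw [filter_filter]
        congr 1; ext k; simp [and_comm]
      simp only [ty, hf]
      rw [hammingNorm, ← card_union_of_disjoint, ← filter_or]
      · congr 1; ext k
        simp only [mem_filter, mem_univ, true_and]
        generalize u k = t
        revert t; decide
      · refine disjoint_filter.2 fun k _ h => ?_
        rw [h]; decide
    have h2 : u ∈ code v ↔ ∑ β, ((ty u).1 β : F) * β = ∑ β, ((ty u).2 β : F) * β := by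
      have hf : ∀ t : ZMod 3, ∑ β, ((#{k | v k = β ∧ u k = t} : ℕ) : F) * β =
          ∑ k, (if u k = t then v k else 0) := by
        intro t
        rw [← sum_fiberwise (s := univ) (g := v)]
        refine sum_congr rfl fun β _ => ?_
        rw [← sum_filter, filter_filter, ← nsmul_eq_mul, ← sum_const]
        refine sum_congr rfl fun k hk => ?_
        simp only [mem_filter] at hk
        exact hk.2.1.symm
      simp only [ty, hf]
      change ∑ k, algebraMap (ZMod 3) F (u k) * v k = 0 ↔ _
      rw [← sub_eq_zero (a := ∑ k, (if u k = 1 then v k else 0)), ← sum_sub_distrib]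
      have : ∀ k, algebraMap (ZMod 3) F (u k) * v k =
          (if u k = 1 then v k else 0) - (if u k = 2 then v k else 0) := by
        intro k
        rw [zmod_three_algebraMap]
        split_ifs <;> simp
      simp only [this]
    rw [h1, h2]
  have h1 : weightDist (code v) j = #{u : Fin N → ZMod 3 | ty u ∈ pairs F j} := by
    rw [weightDist, ← Set.ncard_coe_finset]
    congr 1; ext u; simp [hmem]
  rw [h1, card_eq_sum_card_fiberwise (f := ty) (t := pairs F j) (by intro u; simp)]
  refine sum_congr rfl fun p hp => ?_
  rw [← card_ternary_words_of_type, filter_filter]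
  congr 1; ext u
  simp only [mem_filter, mem_univ, true_and]
  constructor
  · rintro ⟨-, h⟩ β
    simp [← h, ty]
  · intro h
    have : ty u = p := by
      ext β
      · exact (h β).1
      · exact (h β).2
    exact ⟨this ▸ hp, this⟩

theorem weightDist_dcCode {F : Type*} [Field F] [Fintype F] [DecidableEq F] [Algebra (ZMod 3) F]
    {n : ℕ} {D : Set (Mat F n)} (g : Fin D.ncard ≃ D) (j : ℕ) :
    weightDist (dcCode g) j =
      ∑ p ∈ pairs F j, ∏ β, trinom {w ∈ D | w.trace = β}.ncard (p.1 β) (p.2 β) := by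
  rw [dcCode, weightDist_code]
  refine sum_congr rfl fun p _ => prod_congr rfl fun β _ => ?_
  congr 1
  rw [← Set.ncard_coe_finset, ← Set.ncard_image_of_injective (f := fun k => (g k : Mat F n)) _
    (Subtype.val_injective.comp g.injective)]
  congr 1
  ext w
  simp only [coe_filter, mem_univ, true_and, Set.mem_image, Set.mem_ofPred_eq]
  constructor
  · rintro ⟨k, hk, rfl⟩
    exact ⟨(g k).2, hk⟩
  · rintro ⟨hw, hβ⟩
    exact ⟨g.symm ⟨w, hw⟩, by simpa using hβ, by simp⟩

/-! ### Counting a class function on a double coset -/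

/-- Both sides count the pairs `(x, y)` in `H × H` with `f (x s y) = β`. Grouping by `x s y` gives
fibres of size `|H ∩ sHs|`. Grouping by `y` and using `f (x s y) = f (y x s)` makes the product `yx`
range freely over `H`. -/
theorem ncard_doubleCoset_mul {M X : Type*} [Monoid M] [Finite M] (H : Set M)
    (hmul : ∀ x ∈ H, ∀ y ∈ H, x * y ∈ H) (hinv : ∀ x ∈ H, ∃ y ∈ H, x * y = 1 ∧ y * x = 1)
    {s : M} (hs : s * s = 1) (f : M → X) (hf : ∀ x y, f (x * y) = f (y * x)) (β : X) :
    {x | x ∈ H ∧ s * x * s ∈ H}.ncard *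
        {w | w ∈ {w | ∃ x ∈ H, ∃ y ∈ H, w = x * s * y} ∧ f w = β}.ncard =
      H.ncard * {x | x ∈ H ∧ f (x * s) = β}.ncard := by
  classical
  have := Fintype.ofFinite M
  have hL : ∀ x ∈ H, ∀ a b, x * a = x * b → a = b := by
    intro x hx a b hab
    obtain ⟨y, -, -, hy⟩ := hinv x hx
    simpa [← mul_assoc, hy] using congrArg (y * ·) hab
  have hR : ∀ x ∈ H, ∀ a b, a * x = b * x → a = b := by
    intro x hx a b hab
    obtain ⟨y, -, hy, -⟩ := hinv x hx
    simpa [mul_assoc, hy] using congrArg (· * y) hab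
  let T : Finset (M × M) := {p | p.1 ∈ H ∧ p.2 ∈ H ∧ f (p.1 * s * p.2) = β}
  have h1 : T.card = {x | x ∈ H ∧ s * x * s ∈ H}.ncard *
      {w | w ∈ {w | ∃ x ∈ H, ∃ y ∈ H, w = x * s * y} ∧ f w = β}.ncard := by
    rw [Set.ncard_eq_toFinset_card' {w | w ∈ {w | ∃ x ∈ H, ∃ y ∈ H, w = x * s * y} ∧ f w = β},
      mul_comm]
    choose! i hi using hinv
    rw [card_eq_sum_card_fiberwise (f := fun p => p.1 * s * p.2)
      (t := {w | w ∈ {w | ∃ x ∈ H, ∃ y ∈ H, w = x * s * y} ∧ f w = β}.toFinset)]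
    · refine sum_const_nat ?_
      intro w hw
      simp only [Set.mem_ofPred_eq, Set.mem_toFinset] at hw
      obtain ⟨⟨x, hx, y, hy, rfl⟩, hβ⟩ := hw
      rw [← Set.ncard_coe_finset]
      symm
      -- The fibre over `x s y` is a torsor: `a` in `H ∩ sHs` moves `(x, y)` to `(x (s a s)⁻¹, a
      -- y)`.
      refine Set.ncard_congr (fun a _ => (x * i (s * a * s), a * y)) ?_ ?_ ?_
      · rintro a ⟨ha, ha'⟩
        have e : x * i (s * a * s) * s * (a * y) = x * s * y := by
          have e1 : s * (a * y) = s * a * s * (s * y) := by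
            simp only [mul_assoc]
            rw [← mul_assoc s s y, hs, one_mul]
          rw [mul_assoc _ s, e1, ← mul_assoc, mul_assoc x, (hi _ ha').2.2, mul_one, mul_assoc]
        simp only [T, coe_filter, mem_filter, mem_univ, true_and, Set.mem_ofPred_eq]
        exact ⟨⟨hmul _ hx _ (hi _ ha').1, hmul _ ha _ hy, by rw [e]; exact hβ⟩, e⟩
      · rintro a b ⟨ha, ha'⟩ ⟨hb, hb'⟩ he
        simp only [Prod.mk.injEq] at he
        exact hR _ hy _ _ he.2
      · rintro ⟨x', y'⟩ h
        simp only [T, coe_filter, mem_filter, mem_univ, true_and, Set.mem_ofPred_eq] at h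
        obtain ⟨⟨hx', hy', -⟩, he⟩ := h
        have e : s * (y' * i y) * s = i x' * x := by
          apply hL _ hx'
          rw [← mul_assoc x' (i x'), (hi _ hx').2.1, one_mul]
          have e1 : x' * (s * (y' * i y) * s) = x' * s * y' * i y * s := by simp only [mul_assoc]
          rw [e1, he, mul_assoc (x * s), (hi _ hy).2.1, mul_one, mul_assoc, hs, mul_one]
        have hm : s * (y' * i y) * s ∈ H := e ▸ hmul _ (hi _ hx').1 _ hx
        refine ⟨y' * i y, ⟨hmul _ hy' _ (hi _ hy).1, hm⟩, ?_⟩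
        simp only [Prod.mk.injEq]
        constructor
        · apply hR _ hm
          rw [mul_assoc, (hi _ hm).2.2, e, ← mul_assoc, (hi _ hx').2.1, one_mul, mul_one]
        · rw [mul_assoc, (hi _ hy).2.2, mul_one]
    · intro p hp
      simp only [T, coe_filter, mem_univ, true_and, Set.mem_ofPred_eq] at hp
      simp only [Set.coe_toFinset, Set.mem_ofPred_eq]
      exact ⟨⟨p.1, hp.1, p.2, hp.2.1, rfl⟩, hp.2.2⟩
  have h2 : T.card = H.ncard * {x | x ∈ H ∧ f (x * s) = β}.ncard := by
    rw [← Set.ncard_coe_finset, ← Set.ncard_prod]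
    choose! i hi using hinv
    refine Set.ncard_congr (fun p _ => (p.2, p.2 * p.1)) ?_ ?_ ?_
    · rintro ⟨x, y⟩ h
      simp only [T, coe_filter, mem_univ, true_and, Set.mem_ofPred_eq] at h
      refine ⟨h.2.1, hmul _ h.2.1 _ h.1, ?_⟩
      simp only
      rw [mul_assoc, hf]; exact h.2.2
    · rintro ⟨x, y⟩ ⟨x', y'⟩ h h' he
      simp only [Prod.mk.injEq] at he
      obtain ⟨rfl, he⟩ := he
      simp only [T, coe_filter, mem_univ, true_and, Set.mem_ofPred_eq] at h
      rw [hL y h.2.1 _ _ he]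
    · rintro ⟨y, x⟩ ⟨hy, hx, hb⟩
      simp only at hy hx hb
      have e : y * (i y * x) = x := by rw [← mul_assoc, (hi y hy).2.1, one_mul]
      refine ⟨(i y * x, y), ?_, by simp [e]⟩
      simp only [T, coe_filter, mem_univ, true_and, Set.mem_ofPred_eq]
      refine ⟨hmul _ (hi y hy).1 _ hx, hy, ?_⟩
      rw [hf, ← mul_assoc, e]; exact hb
  rw [← h1, h2]

/-! ### The group `Q` -/

section Group

open Matrix

variable {F : Type*} [Field F] {n : ℕ}

/-- The Gram matrix of the symmetric bilinear form preserved by `Q`. -/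
def gram (F : Type*) [Field F] (n : ℕ) : Mat F n := fromBlocks (fromBlocks 0 1 1 0) 0 0 1

/-- The projection to the first `r` coordinates. -/
def headProj (F : Type*) [Field F] (n r : ℕ) : Matrix (Fin n) (Fin n) F :=
  diagonal fun i => if (i : ℕ) < r then 1 else 0

/-- The projection to the last `n - r` coordinates. -/
def tailProj (F : Type*) [Field F] (n r : ℕ) : Matrix (Fin n) (Fin n) F :=
  diagonal fun i => if (i : ℕ) < r then 0 else 1

theorem headProj_mul_self (r : ℕ) : headProj F n r * headProj F n r = headProj F n r := by
  simp [headProj, diagonal_mul_diagonal]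

theorem tailProj_mul_self (r : ℕ) : tailProj F n r * tailProj F n r = tailProj F n r := by
  simp [tailProj, diagonal_mul_diagonal]

theorem headProj_mul_tailProj (r : ℕ) : headProj F n r * tailProj F n r = 0 := by
  rw [headProj, tailProj, diagonal_mul_diagonal, ← diagonal_zero]
  congr 1; ext i; split_ifs <;> simp

theorem tailProj_mul_headProj (r : ℕ) : tailProj F n r * headProj F n r = 0 := by
  rw [headProj, tailProj, diagonal_mul_diagonal, ← diagonal_zero]
  congr 1; ext i; split_ifs <;> simp

theorem headProj_add_tailProj (r : ℕ) : headProj F n r + tailProj F n r = 1 := by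
  rw [headProj, tailProj, diagonal_add, ← diagonal_one]
  congr 1; ext i; split_ifs <;> simp

theorem headProj_transpose (r : ℕ) : (headProj F n r)ᵀ = headProj F n r := diagonal_transpose _

theorem tailProj_transpose (r : ℕ) : (tailProj F n r)ᵀ = tailProj F n r := diagonal_transpose _

theorem sigma_eq (r : ℕ) : sigma F n r = fromBlocks (fromBlocks (tailProj F n r) (headProj F n r)
    (headProj F n r) (tailProj F n r)) 0 0 1 := rfl

theorem sigma_mul_self (r : ℕ) : sigma F n r * sigma F n r = 1 := by
  simp only [sigma_eq, fromBlocks_multiply, headProj_mul_self, tailProj_mul_self,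
    headProj_mul_tailProj, tailProj_mul_headProj]
  simp [headProj_add_tailProj, add_comm (tailProj F n r)]

theorem sigma_transpose (r : ℕ) : (sigma F n r)ᵀ = sigma F n r := by
  simp [sigma_eq, fromBlocks_transpose, headProj_transpose, tailProj_transpose]

theorem sigma_gram (r : ℕ) : sigma F n r * gram F n * sigma F n r = gram F n := by
  simp [sigma_eq, gram, fromBlocks_multiply, headProj_mul_self, tailProj_mul_self,
    headProj_mul_tailProj, tailProj_mul_headProj, headProj_add_tailProj,
    add_comm (tailProj F n r)]

theorem levi_mul_unip (A : GL (Fin n) F) (B : Matrix (Fin n) (Fin n) F)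
    (h : Matrix Unit (Fin n) F) :
    levi A * unip B h = fromBlocks
      (fromBlocks (A : Matrix (Fin n) (Fin n) F) ((A : Matrix (Fin n) (Fin n) F) * B) 0
        (((A⁻¹ : GL (Fin n) F) : Matrix (Fin n) (Fin n) F)ᵀ))
      (fromRows (-((A : Matrix (Fin n) (Fin n) F) * hᵀ)) 0) (fromCols 0 h) 1 := by
  simp [levi, unip, fromBlocks_multiply, fromBlocks_mul_fromRows]

theorem levi_mul_unip_inj {A A' : GL (Fin n) F} {B B' : Matrix (Fin n) (Fin n) F}
    {h h' : Matrix Unit (Fin n) F} (e : levi A * unip B h = levi A' * unip B' h') :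
    A = A' ∧ B = B' ∧ h = h' := by
  rw [levi_mul_unip, levi_mul_unip, fromBlocks_inj, fromBlocks_inj, fromCols_ext_iff] at e
  obtain ⟨⟨hA, hB, -, -⟩, -, ⟨-, hh⟩, -⟩ := e
  have hA' : A = A' := Units.ext hA
  subst hA'
  refine ⟨rfl, ?_, hh⟩
  simpa [← mul_assoc] using congrArg (((A⁻¹ : GL (Fin n) F) : Matrix (Fin n) (Fin n) F) * ·) hB

/-- A matrix whose blocks below the first diagonal block vanish, with last entry `1`. -/
def parab (X Y V : Matrix (Fin n) (Fin n) F) (z t : Matrix (Fin n) Unit F)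
    (h : Matrix Unit (Fin n) F) : Mat F n :=
  fromBlocks (fromBlocks X Y 0 V) (fromRows z t) (fromCols 0 h) 1

/-- Equating these blocks with those of the Gram matrix yields the defining equations of `Q`,
including the relation between `B` and `h`. -/
theorem parab_transpose_mul_gram_mul (X Y V : Matrix (Fin n) (Fin n) F)
    (z t : Matrix (Fin n) Unit F) (h : Matrix Unit (Fin n) F) :
    (parab X Y V z t h)ᵀ * gram F n * parab X Y V z t h =
      fromBlocks (fromBlocks 0 (Xᵀ * V) (Vᵀ * X) (Vᵀ * Y + Yᵀ * V + hᵀ * h))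
        (fromRows (Xᵀ * t) (Vᵀ * z + Yᵀ * t + hᵀ)) (fromCols (tᵀ * X) (tᵀ * Y + zᵀ * V + h))
        (tᵀ * z + zᵀ * t + 1) := by
  have e1 : (fromBlocks 0 (Xᵀ * V) (Vᵀ * X) (Vᵀ * Y + Yᵀ * V) +
      fromBlocks 0 0 0 (hᵀ * h)) =
      fromBlocks 0 (Xᵀ * V) (Vᵀ * X) (Vᵀ * Y + Yᵀ * V + hᵀ * h) := by
    simp [fromBlocks_add]
  have e2 : ∀ a b c : Matrix (Fin n) Unit F, fromRows a b + fromRows 0 c = fromRows a (b + c) := by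
    intro a b c; ext (i | i) j <;> simp
  have e3 : ∀ (a b c : Matrix Unit (Fin n) F), fromCols a b + fromCols 0 c = fromCols a (b + c) := by
    intro a b c; ext i (j | j) <;> simp
  simp only [parab, gram, fromBlocks_transpose, fromBlocks_multiply, transpose_fromRows,
      transpose_fromCols, fromCols_mul_fromBlocks, fromBlocks_mul_fromRows, fromRows_mul_fromCols,
      fromCols_mul_fromRows, Matrix.mul_zero, Matrix.zero_mul, Matrix.mul_one, Matrix.one_mul,
      add_zero, zero_add, transpose_zero, transpose_one, e1, e2, e3]

theorem levi_mul_unip_eq_parab (A : GL (Fin n) F) (B : Matrix (Fin n) (Fin n) F)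
    (h : Matrix Unit (Fin n) F) :
    levi A * unip B h = parab (A : Matrix (Fin n) (Fin n) F) ((A : Matrix (Fin n) (Fin n) F) * B)
      ((A⁻¹ : GL (Fin n) F) : Matrix (Fin n) (Fin n) F)ᵀ
      (-((A : Matrix (Fin n) (Fin n) F) * hᵀ)) 0 h :=
  levi_mul_unip A B h

/-- For an isometry of this shape `V` is the inverse transpose of `X`; then `Xᵀ t = 0` forces `t =
0`, and the remaining column `z` is determined by `X` and `h`. -/
theorem parab_mem_Q {X Y V : Matrix (Fin n) (Fin n) F} {z t : Matrix (Fin n) Unit F}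
    {h : Matrix Unit (Fin n) F}
    (H : (parab X Y V z t h)ᵀ * gram F n * parab X Y V z t h = gram F n) :
    parab X Y V z t h ∈ Q F n := by
  rw [parab_transpose_mul_gram_mul, gram, fromBlocks_inj, fromBlocks_inj] at H
  obtain ⟨⟨-, h1, h2, h3⟩, h4, -, -⟩ := H
  rw [← fromRows_zero, fromRows_ext_iff] at h4
  obtain ⟨h4, h5⟩ := h4
  let A : GL (Fin n) F := ⟨X, Vᵀ, mul_eq_one_comm.1 h2, h2⟩
  have hXV : X * Vᵀ = 1 := mul_eq_one_comm.1 h2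
  have hVX : V * Xᵀ = 1 := mul_eq_one_comm.1 h1
  have ht : t = 0 := by
    calc t = V * Xᵀ * t := by rw [hVX, Matrix.one_mul]
      _ = 0 := by rw [Matrix.mul_assoc, h4, Matrix.mul_zero]
  have hz : z = -(X * hᵀ) := by
    rw [ht, Matrix.mul_zero, add_zero] at h5
    calc z = X * Vᵀ * z := by rw [hXV, Matrix.one_mul]
      _ = _ := by rw [Matrix.mul_assoc, eq_neg_of_add_eq_zero_left h5, Matrix.mul_neg]
  refine ⟨A, Vᵀ * Y, h, ?_, ?_⟩
  · rw [transpose_mul, transpose_transpose]; exact h3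
  · rw [levi_mul_unip_eq_parab, ht, hz]
    change _ = parab X (X * (Vᵀ * Y)) Vᵀᵀ (-(X * hᵀ)) 0 h
    rw [← mul_assoc, hXV, one_mul, transpose_transpose]

/-- This describes `Q` as the isometries with prescribed zero blocks and last entry 1. Closure under
products, and membership of a conjugate by `σ_r`, then become block checks, since the isometry
condition is preserved automatically. -/
theorem mem_Q_iff (w : Mat F n) : w ∈ Q F n ↔ wᵀ * gram F n * w = gram F n ∧
    w.toBlocks₁₁.toBlocks₂₁ = 0 ∧ w.toBlocks₂₁.toCols₁ = 0 ∧ w.toBlocks₂₂ = 1 := by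
  constructor
  · rintro ⟨A, B, h, hB, rfl⟩
    rw [levi_mul_unip_eq_parab]
    refine ⟨?_, by simp [parab], by simp [parab], by simp [parab]⟩
    have e : Bᵀ * (A : Matrix (Fin n) (Fin n) F)ᵀ *
        ((A⁻¹ : GL (Fin n) F) : Matrix (Fin n) (Fin n) F)ᵀ = Bᵀ := by
      rw [mul_assoc, ← transpose_mul]; simp
    have e1 : (A : Matrix (Fin n) (Fin n) F)ᵀ *
        ((A⁻¹ : GL (Fin n) F) : Matrix (Fin n) (Fin n) F)ᵀ = 1 := by
      rw [← transpose_mul]; simp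
    have e2 : ∀ {o : Type} (C : Matrix (Fin n) o F),
        ((A⁻¹ : GL (Fin n) F) : Matrix (Fin n) (Fin n) F) *
        ((A : Matrix (Fin n) (Fin n) F) * C) = C := by
      intro o C; rw [← Matrix.mul_assoc]; simp
    have e3 : h * (A : Matrix (Fin n) (Fin n) F)ᵀ *
        ((A⁻¹ : GL (Fin n) F) : Matrix (Fin n) (Fin n) F)ᵀ = h := by
      rw [Matrix.mul_assoc, e1, Matrix.mul_one]
    rw [parab_transpose_mul_gram_mul, gram]
    simp only [transpose_transpose, transpose_mul, e, e1, e2, e3, transpose_neg, Matrix.neg_mul,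
      Matrix.mul_neg, hB, Matrix.mul_zero, Matrix.zero_mul, transpose_zero]
    simp
  · rintro ⟨H, h1, h2, h3⟩
    have e : w = parab w.toBlocks₁₁.toBlocks₁₁ w.toBlocks₁₁.toBlocks₁₂ w.toBlocks₁₁.toBlocks₂₂
        w.toBlocks₁₂.toRows₁ w.toBlocks₁₂.toRows₂ w.toBlocks₂₁.toCols₂ := by
      rw [parab, ← h1, ← h2, ← h3]
      simp only [fromBlocks_toBlocks, fromRows_toRows, fromCols_toCols]
    rw [e] at H ⊢
    exact parab_mem_Q H

theorem Q_mul_mem {x y : Mat F n} (hx : x ∈ Q F n) (hy : y ∈ Q F n) : x * y ∈ Q F n := by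
  have hx' := ((mem_Q_iff x).1 hx).1
  have hy' := ((mem_Q_iff y).1 hy).1
  obtain ⟨A, B, h, -, rfl⟩ := hx
  obtain ⟨A', B', h', -, rfl⟩ := hy
  rw [mem_Q_iff]
  refine ⟨?_, ?_⟩
  · calc _ = (levi A' * unip B' h')ᵀ * ((levi A * unip B h)ᵀ * gram F n * (levi A * unip B h)) *
          (levi A' * unip B' h') := by simp only [transpose_mul, mul_assoc]
      _ = _ := by rw [hx', hy']
  · simp only [levi_mul_unip, fromBlocks_multiply]
    refine ⟨?_, ?_, ?_⟩
    · ext i j; simp [toBlocks₂₁]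
    · ext i j; simp [fromCols_mul_fromBlocks]
    · simp [fromCols_mul_fromRows]

theorem unip_mem_Q {B : Matrix (Fin n) (Fin n) F} {h : Matrix Unit (Fin n) F}
    (hB : B + Bᵀ + hᵀ * h = 0) : unip B h ∈ Q F n :=
  ⟨1, B, h, hB, by simp [levi]⟩

theorem levi_mem_Q (A : GL (Fin n) F) : levi A ∈ Q F n :=
  ⟨A, 0, 0, by simp, by simp [unip]⟩

theorem levi_mul_levi (A A' : GL (Fin n) F) : levi A * levi A' = levi (A * A') := by
  simp [levi, fromBlocks_multiply, transpose_mul]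

/-- The relation on `B` and `h` is exactly what cancels the upper right block. -/
theorem unip_mul_unip_inv {B : Matrix (Fin n) (Fin n) F} {h : Matrix Unit (Fin n) F}
    (hB : B + Bᵀ + hᵀ * h = 0) : unip B h * unip Bᵀ (-h) = 1 := by
  have hB' : Bᵀ + B + hᵀ * h = 0 := by rw [← hB, add_comm Bᵀ]
  simp only [unip, fromBlocks_multiply, fromCols_mul_fromBlocks, fromBlocks_mul_fromRows,
      fromRows_mul_fromCols, fromCols_mul_fromRows]
  rw [← fromBlocks_one]
  congr 1
  · simp [fromBlocks_add, hB']
  · ext (i | i) j <;> simp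
  · ext i (j | j) <;> simp
  · simp

theorem Q_exists_inv {x : Mat F n} (hx : x ∈ Q F n) : ∃ y ∈ Q F n, x * y = 1 ∧ y * x = 1 := by
  obtain ⟨A, B, h, hB, rfl⟩ := hx
  have e : levi A * unip B h * (unip Bᵀ (-h) * levi A⁻¹) = 1 := by
    rw [mul_assoc, ← mul_assoc (unip B h), unip_mul_unip_inv hB, one_mul, levi_mul_levi]
    simp [levi]
  refine ⟨_, Q_mul_mem (unip_mem_Q ?_) (levi_mem_Q A⁻¹), e, mul_eq_one_comm.1 e⟩
  rw [transpose_transpose, transpose_neg, Matrix.neg_mul, Matrix.mul_neg, neg_neg, ← hB,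
    add_comm Bᵀ]

theorem trace_levi_mul_unip_mul_sigma (A : GL (Fin n) F) (B : Matrix (Fin n) (Fin n) F)
    (h : Matrix Unit (Fin n) F) (r : ℕ) :
    (levi A * unip B h * sigma F n r).trace =
      trace ((A : Matrix (Fin n) (Fin n) F) * tailProj F n r) +
      trace (((A⁻¹ : GL (Fin n) F) : Matrix (Fin n) (Fin n) F) * tailProj F n r) +
      trace ((A : Matrix (Fin n) (Fin n) F) * B * headProj F n r) + 1 := by
  have e : trace (((A⁻¹ : GL (Fin n) F) : Matrix (Fin n) (Fin n) F)ᵀ * tailProj F n r) =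
      trace (((A⁻¹ : GL (Fin n) F) : Matrix (Fin n) (Fin n) F) * tailProj F n r) := by
    rw [← trace_transpose, transpose_mul, transpose_transpose, tailProj_transpose, trace_mul_comm]
  have tr : ∀ {a b : Type} [Fintype a] [Fintype b] (X : Matrix a a F) (Y : Matrix a b F)
      (Z : Matrix b a F) (W : Matrix b b F), trace (fromBlocks X Y Z W) = trace X + trace W := by
    intro a b _ _ X Y Z W
    simp [trace]
  rw [levi_mul_unip, sigma_eq, fromBlocks_multiply, tr]
  simp only [fromBlocks_multiply, Matrix.mul_zero, Matrix.zero_mul, add_zero, zero_add,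
    tr, trace_add, e, Matrix.mul_one]
  simp only [trace_one, Fintype.card_unit, Nat.cast_one]
  ring

/-- As `σ_r` is itself an isometry, only the vanishing of the two lower left blocks has to be
tested; the last entry stays 1. -/
theorem sigma_conj_mem_Q_iff {A : GL (Fin n) F} {B : Matrix (Fin n) (Fin n) F}
    {h : Matrix Unit (Fin n) F} (hB : B + Bᵀ + hᵀ * h = 0) (r : ℕ) :
    sigma F n r * (levi A * unip B h) * sigma F n r ∈ Q F n ↔
      headProj F n r * ((A : Matrix (Fin n) (Fin n) F) * tailProj F n r +
        (A : Matrix (Fin n) (Fin n) F) * B * headProj F n r) + tailProj F n r *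
        (((A⁻¹ : GL (Fin n) F) : Matrix (Fin n) (Fin n) F)ᵀ * headProj F n r) = 0 ∧
      h * headProj F n r = 0 := by
  have hJ := ((mem_Q_iff (levi A * unip B h)).1 ⟨A, B, h, hB, rfl⟩).1
  rw [mem_Q_iff]
  have e1 : (sigma F n r * (levi A * unip B h) * sigma F n r)ᵀ * gram F n *
      (sigma F n r * (levi A * unip B h) * sigma F n r) = gram F n := by
    calc _ = sigma F n r * ((levi A * unip B h)ᵀ * (sigma F n r * gram F n * sigma F n r) *
        (levi A * unip B h)) * sigma F n r := by
          simp only [transpose_mul, sigma_transpose, mul_assoc]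
      _ = _ := by rw [sigma_gram, hJ, sigma_gram]
  rw [and_iff_right e1, levi_mul_unip, sigma_eq]
  simp only [fromBlocks_multiply, fromCols_mul_fromBlocks, Matrix.mul_zero, Matrix.zero_mul,
    add_zero, zero_add, Matrix.one_mul, Matrix.mul_one, toBlocks_fromBlocks₁₁,
    toBlocks_fromBlocks₂₁, toBlocks_fromBlocks₂₂, toCols₁_fromCols, and_true, mul_add, add_mul,
    mul_assoc, add_assoc]

end Group

/-! ### Parametrization of `Q` by `GL`, skew-symmetric matrices and vectors -/

section Param

open Matrix

/-- The skew-symmetric matrices. -/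
abbrev Skew (F : Type*) [Field F] (m : Type*) : Type _ := {K : Matrix m m F // K + Kᵀ = 0}

variable {F : Type*} [Field F]

/-- The element of `Q` with Levi part `A`, skew part `K` and vector part `v`. -/
def qMat {r k : ℕ} (t : GL (Fin r ⊕ Fin k) F × Skew F (Fin r ⊕ Fin k) × (Fin r ⊕ Fin k → F)) :
    Mat F (r + k) :=
  levi (Units.mapEquiv (reindexAlgEquiv F F finSumFinEquiv).toMulEquiv t.1) *
    unip (reindexAlgEquiv F F finSumFinEquiv (t.2.1.1 + vecMulVec t.2.2 t.2.2))
      (replicateRow Unit (t.2.2 ∘ finSumFinEquiv.symm))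

theorem replicateRow_transpose_mul_self {r k : ℕ} (v : Fin r ⊕ Fin k → F) :
    (replicateRow Unit (v ∘ finSumFinEquiv.symm))ᵀ * replicateRow Unit (v ∘ finSumFinEquiv.symm) =
      reindexAlgEquiv F F finSumFinEquiv (vecMulVec v v) := by
  ext i j
  simp [Matrix.mul_apply, vecMulVec_apply]

theorem reindex_transpose' {r k : ℕ} (X : Matrix (Fin r ⊕ Fin k) (Fin r ⊕ Fin k) F) :
    (reindexAlgEquiv F F finSumFinEquiv X)ᵀ = reindexAlgEquiv F F finSumFinEquiv Xᵀ := rfl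

theorem trace_reindex' {r k : ℕ} (X : Matrix (Fin r ⊕ Fin k) (Fin r ⊕ Fin k) F) :
    (reindexAlgEquiv F F finSumFinEquiv X).trace = X.trace := by
  simp only [trace, diag_apply, coe_reindexAlgEquiv, reindex_apply, submatrix_apply]
  exact Equiv.sum_comp finSumFinEquiv.symm fun i => X i i

theorem headProj_eq (r k : ℕ) : headProj F (r + k) r =
    reindexAlgEquiv F F finSumFinEquiv (fromBlocks 1 0 0 0) := by
  ext i j
  obtain ⟨i, rfl⟩ := finSumFinEquiv.surjective i
  obtain ⟨j, rfl⟩ := finSumFinEquiv.surjective j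
  rcases i with i | i <;> rcases j with j | j <;>
    simp [headProj, diagonal_apply, one_apply, Fin.ext_iff]
  omega

theorem tailProj_eq (r k : ℕ) : tailProj F (r + k) r =
    reindexAlgEquiv F F finSumFinEquiv (fromBlocks 0 0 0 1) := by
  ext i j
  obtain ⟨i, rfl⟩ := finSumFinEquiv.surjective i
  obtain ⟨j, rfl⟩ := finSumFinEquiv.surjective j
  rcases i with i | i <;> rcases j with j | j <;>
    simp [tailProj, diagonal_apply, one_apply, Fin.ext_iff]
  omega

theorem three_eq_zero [Algebra (ZMod 3) F] : (3 : F) = 0 := by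
  have h : (3 : ZMod 3) = 0 := by decide
  rw [← map_ofNat (algebraMap (ZMod 3) F) 3, h, map_zero]

/-- The usual parametrisation is `B = K - ᵗvv/2`; in characteristic 3 the coefficient `-1/2` is 1,
and the symmetric contributions add up to `3 ᵗvv = 0`. -/
theorem skew_param {r k : ℕ} (h3 : (3 : F) = 0) (K : Skew F (Fin r ⊕ Fin k))
    (v : Fin r ⊕ Fin k → F) :
    reindexAlgEquiv F F finSumFinEquiv (K.1 + vecMulVec v v) +
      (reindexAlgEquiv F F finSumFinEquiv (K.1 + vecMulVec v v))ᵀ +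
      (replicateRow Unit (v ∘ finSumFinEquiv.symm))ᵀ * replicateRow Unit (v ∘ finSumFinEquiv.symm)
        = 0 := by
  rw [replicateRow_transpose_mul_self, reindex_transpose', ← map_add, ← map_add,
    map_eq_zero_iff _ (AlgEquiv.injective _), transpose_add]
  have hv : (vecMulVec v v)ᵀ = vecMulVec v v := by
    ext i j; simp [vecMulVec_apply, mul_comm]
  have hV : vecMulVec v v + vecMulVec v v + vecMulVec v v = 0 := by
    ext i j; simp only [Matrix.add_apply, Matrix.zero_apply]; linear_combination h3 * vecMulVec v v i j
  have e : K.1 + vecMulVec v v + (K.1ᵀ + vecMulVec v v) + vecMulVec v v =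
      (K.1 + K.1ᵀ) + (vecMulVec v v + vecMulVec v v + vecMulVec v v) := by abel
  rw [hv, e, K.2, hV, add_zero]

theorem qMat_injective {r k : ℕ} : Function.Injective (qMat (F := F) (r := r) (k := k)) := by
  rintro ⟨A, K, v⟩ ⟨A', K', v'⟩ h
  obtain ⟨hA, hB, hv⟩ := levi_mul_unip_inj h
  have hA' : A = A' := (Units.mapEquiv _).injective hA
  have hv' : v = v' := by
    funext i
    simpa using congrFun (congrFun hv ()) (finSumFinEquiv i)
  subst hv'
  have := (reindexAlgEquiv F F finSumFinEquiv).injective hB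
  simp only [add_left_inj] at this
  rw [hA', Subtype.ext this]

theorem range_qMat (h3 : (3 : F) = 0) (r k : ℕ) :
    Set.range (qMat (F := F) (r := r) (k := k)) = Q F (r + k) := by
  ext w
  constructor
  · rintro ⟨⟨A, K, v⟩, rfl⟩
    exact ⟨_, _, _, skew_param h3 K v, rfl⟩
  · rintro ⟨A, B, h, hB, rfl⟩
    let v : Fin r ⊕ Fin k → F := h () ∘ finSumFinEquiv
    have hh : replicateRow Unit (v ∘ finSumFinEquiv.symm) = h := by
      ext i j; simp [v]
    let φ := reindexAlgEquiv F F (finSumFinEquiv (m := r) (n := k))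
    -- The skew part is recovered by removing the symmetric term `ᵗvv`, which again uses `3 = 0`.
    have hK : (φ.symm B - vecMulVec v v) + (φ.symm B - vecMulVec v v)ᵀ = 0 := by
      apply φ.injective
      rw [map_zero, ← hB, map_add, ← hh, replicateRow_transpose_mul_self, ← reindex_transpose']
      change φ _ + (φ _)ᵀ = _
      rw [map_sub, φ.apply_symm_apply, transpose_sub]
      have hv : (φ (vecMulVec v v))ᵀ = φ (vecMulVec v v) := by
        ext i j; simp [φ, vecMulVec_apply, mul_comm]
      have hV : φ (vecMulVec v v) + φ (vecMulVec v v) + φ (vecMulVec v v) = 0 := by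
        ext i j; simp only [Matrix.add_apply, Matrix.zero_apply]
        linear_combination h3 * φ (vecMulVec v v) i j
      change _ = B + Bᵀ + φ (vecMulVec v v)
      have e : B + Bᵀ + φ (vecMulVec v v) = B - φ (vecMulVec v v) + (Bᵀ - φ (vecMulVec v v)) +
          (φ (vecMulVec v v) + φ (vecMulVec v v) + φ (vecMulVec v v)) := by abel
      rw [hv, e, hV, add_zero]
    refine ⟨((Units.mapEquiv φ.toMulEquiv).symm A, ⟨_, hK⟩, v), ?_⟩
    rw [qMat, hh]
    congr 2
    · exact (Units.mapEquiv φ.toMulEquiv).apply_symm_apply A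
    · simp only [sub_add_cancel]
      exact φ.apply_symm_apply B

theorem ncard_Q_filter (h3 : (3 : F) = 0) (r k : ℕ) (P : Mat F (r + k) → Prop) :
    {w | w ∈ Q F (r + k) ∧ P w}.ncard = {t | P (qMat (F := F) (r := r) (k := k) t)}.ncard := by
  rw [← Set.ncard_image_of_injective _ qMat_injective]
  congr 1
  ext w
  rw [← range_qMat h3]
  constructor
  · rintro ⟨⟨t, rfl⟩, h⟩; exact ⟨t, h, rfl⟩
  · rintro ⟨t, h, rfl⟩; exact ⟨⟨t, rfl⟩, h⟩

theorem trace_qMat_mul_sigma {r k : ℕ} (A : GL (Fin r ⊕ Fin k) F) (K : Skew F (Fin r ⊕ Fin k))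
    (v : Fin r ⊕ Fin k → F) :
    (qMat (A, K, v) * sigma F (r + k) r).trace =
      trace (A : Matrix (Fin r ⊕ Fin k) (Fin r ⊕ Fin k) F).toBlocks₂₂ +
      trace ((A⁻¹ : GL (Fin r ⊕ Fin k) F) : Matrix (Fin r ⊕ Fin k) (Fin r ⊕ Fin k) F).toBlocks₂₂ +
      trace (fromBlocks 1 0 0 0 * (A : Matrix (Fin r ⊕ Fin k) (Fin r ⊕ Fin k) F) *
        (K.1 + vecMulVec v v)) + 1 := by
  have hE : ∀ X : Matrix (Fin r ⊕ Fin k) (Fin r ⊕ Fin k) F,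
      trace (X * fromBlocks 0 0 0 1) = trace X.toBlocks₂₂ := by
    intro X
    conv_lhs => rw [← fromBlocks_toBlocks X, fromBlocks_multiply]
    simp [trace]
  rw [qMat, trace_levi_mul_unip_mul_sigma, headProj_eq, tailProj_eq, ← map_inv]
  simp only [Units.coe_mapEquiv]
  change trace (reindexAlgEquiv F F finSumFinEquiv _ * _) +
    trace (reindexAlgEquiv F F finSumFinEquiv _ * _) +
    trace (reindexAlgEquiv F F finSumFinEquiv _ * _ * _) + 1 = _
  simp only [← map_mul, trace_reindex', hE]
  rw [trace_mul_comm (_ * _) (fromBlocks 1 0 0 0), mul_assoc]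

/-- Once the head of `v` vanishes, three blocks must be zero: the head block of `A(K + ᵗvv)`, the
block `A₁₂`, and the transpose of `(A⁻¹)₁₂`. The second makes `A₁₁` invertible, so the first says
`K₁₁ = 0` and the third is automatic. -/
theorem sigma_conj_qMat_mem_Q_iff (h3 : (3 : F) = 0) {r k : ℕ} (A : GL (Fin r ⊕ Fin k) F)
    (K : Skew F (Fin r ⊕ Fin k)) (v : Fin r ⊕ Fin k → F) :
    sigma F (r + k) r * qMat (A, K, v) * sigma F (r + k) r ∈ Q F (r + k) ↔
      (A : Matrix (Fin r ⊕ Fin k) (Fin r ⊕ Fin k) F).toBlocks₁₂ = 0 ∧ K.1.toBlocks₁₁ = 0 ∧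
        ∀ i, v (Sum.inl i) = 0 := by
  rw [qMat, sigma_conj_mem_Q_iff (skew_param h3 K v), headProj_eq, tailProj_eq, ← map_inv]
  simp only [Units.coe_mapEquiv]
  change reindexAlgEquiv F F finSumFinEquiv _ * (reindexAlgEquiv F F finSumFinEquiv _ *
    reindexAlgEquiv F F finSumFinEquiv _ + reindexAlgEquiv F F finSumFinEquiv _ *
    reindexAlgEquiv F F finSumFinEquiv _ * reindexAlgEquiv F F finSumFinEquiv _) +
    reindexAlgEquiv F F finSumFinEquiv _ * ((reindexAlgEquiv F F finSumFinEquiv _)ᵀ *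
    reindexAlgEquiv F F finSumFinEquiv _) = 0 ∧ _ ↔ _
  simp only [reindex_transpose', ← map_mul, ← map_add]
  rw [map_eq_zero_iff _ (AlgEquiv.injective _)]
  have hv : replicateRow Unit (v ∘ (finSumFinEquiv (m := r) (n := k)).symm) *
      reindexAlgEquiv F F (finSumFinEquiv (m := r) (n := k)) (fromBlocks 1 0 0 0) = 0 ↔ ∀ i, v (Sum.inl i) = 0 := by
    rw [← headProj_eq]
    constructor
    · intro h i
      have := congrFun (congrFun h ()) (finSumFinEquiv (Sum.inl i))
      simpa [headProj, mul_diagonal] using this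
    · intro h
      ext u j
      obtain ⟨j, rfl⟩ := finSumFinEquiv.surjective j
      rcases j with j | j <;> simp [headProj, mul_diagonal, h]
  rw [hv, ← and_assoc]
  refine and_congr_left fun hv' => ?_
  set X : Matrix (Fin r ⊕ Fin k) (Fin r ⊕ Fin k) F := A.val
  set Y : Matrix (Fin r ⊕ Fin k) (Fin r ⊕ Fin k) F := (A⁻¹).val
  have hXY : X * Y = 1 := by simp [X, Y]
  have hV : (vecMulVec v v).toBlocks₁₁ = 0 := by
    ext i j; simp [toBlocks₁₁, vecMulVec_apply, hv']
  have hb : ∀ Z W : Matrix (Fin r ⊕ Fin k) (Fin r ⊕ Fin k) F,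
      fromBlocks 1 0 0 0 * (X * fromBlocks 0 0 0 1 + Z * fromBlocks 1 0 0 0) +
        fromBlocks 0 0 0 1 * (W * fromBlocks 1 0 0 0) =
      fromBlocks Z.toBlocks₁₁ X.toBlocks₁₂ W.toBlocks₂₁ 0 := by
    intro Z W
    conv_lhs => rw [← fromBlocks_toBlocks X, ← fromBlocks_toBlocks Z, ← fromBlocks_toBlocks W]
    simp [fromBlocks_multiply, fromBlocks_add]
  have hz : ∀ a b c d, fromBlocks a b c d = (0 : Matrix (Fin r ⊕ Fin k) (Fin r ⊕ Fin k) F) ↔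
      a = 0 ∧ b = 0 ∧ c = 0 ∧ d = 0 := by
    intro a b c d
    rw [← fromBlocks_zero, fromBlocks_inj]
  rw [hb, hz]
  have hXY1 : X.toBlocks₁₁ * Y.toBlocks₁₁ + X.toBlocks₁₂ * Y.toBlocks₂₁ = 1 ∧
      X.toBlocks₁₁ * Y.toBlocks₁₂ + X.toBlocks₁₂ * Y.toBlocks₂₂ = 0 := by
    rw [← fromBlocks_toBlocks X, ← fromBlocks_toBlocks Y, fromBlocks_multiply, ← fromBlocks_one,
      fromBlocks_inj] at hXY
    exact ⟨hXY.1, hXY.2.1⟩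
  have hZ : (X * (K.1 + vecMulVec v v)).toBlocks₁₁ = X.toBlocks₁₁ * K.1.toBlocks₁₁ +
      X.toBlocks₁₂ * (K.1 + vecMulVec v v).toBlocks₂₁ := by
    have h1 : (K.1 + vecMulVec v v).toBlocks₁₁ = K.1.toBlocks₁₁ := by
      change K.1.toBlocks₁₁ + (vecMulVec v v).toBlocks₁₁ = _
      rw [hV, add_zero]
    conv_lhs => rw [← fromBlocks_toBlocks X, ← fromBlocks_toBlocks (K.1 + vecMulVec v v)]
    rw [fromBlocks_multiply, toBlocks_fromBlocks₁₁, h1]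
  rw [hZ]
  have inv : X.toBlocks₁₂ = 0 → Y.toBlocks₁₁ * X.toBlocks₁₁ = 1 := by
    intro h
    rw [h, Matrix.zero_mul, add_zero] at hXY1
    exact mul_eq_one_comm.1 hXY1.1
  constructor
  · rintro ⟨h1, h2, -, -⟩
    refine ⟨h2, ?_⟩
    rw [h2, Matrix.zero_mul, add_zero] at h1
    rw [← Matrix.one_mul K.1.toBlocks₁₁, ← inv h2, Matrix.mul_assoc, h1, Matrix.mul_zero]
  · rintro ⟨h1, h2⟩
    refine ⟨by rw [h1, h2]; simp, h1, ?_, rfl⟩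
    have h3 := hXY1.2
    rw [h1, Matrix.zero_mul, add_zero] at h3
    change Y.toBlocks₁₂ᵀ = 0
    rw [← Matrix.one_mul Y.toBlocks₁₂, ← inv h1, Matrix.mul_assoc, h3, Matrix.mul_zero,
      transpose_zero]

end Param

/-! ### Counting invertible symmetric matrices -/

section Symm

open Matrix

theorem natCard_matrix (R o m : Type*) [Finite R] [Fintype m] [Fintype o] :
    Nat.card (Matrix o m R) = Nat.card R ^ (Fintype.card o * Fintype.card m) := by
  rw [Matrix, Nat.card_fun, Nat.card_fun, ← pow_mul, Nat.card_eq_fintype_card (α := m),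
    Nat.card_eq_fintype_card (α := o), mul_comm]

theorem isSymm_unit {R : Type*} (a : Matrix Unit Unit R) : a.IsSymm := by ext; rfl

/-- The invertible symmetric matrices. -/
abbrev SymInv (F : Type*) [Field F] (m : Type*) [Fintype m] [DecidableEq m] : Type _ :=
  {S : Matrix m m F // S.IsSymm ∧ S.det ≠ 0}

variable {F : Type*} [Field F] {m o : Type*} [Fintype m] [DecidableEq m] [Fintype o] [DecidableEq o]

theorem card_symInv_congr (e : m ≃ o) : Nat.card (SymInv F m) = Nat.card (SymInv F o) := by
  refine Nat.card_congr ((reindex e e).subtypeEquiv fun S => ?_)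
  rw [reindex_apply, det_submatrix_equiv_self]
  refine and_congr_left fun _ => ?_
  constructor
  · intro h; exact h.submatrix _
  · intro h; simpa using h.submatrix e

/-- Schur complement: with an invertible corner `P`, the translation `S ↦ S - Rᵀ P⁻¹ R` preserves
symmetry and turns the condition into invertibility of the new `S`, with `R` arbitrary. -/
theorem card_borderedSymm_of_det_ne_zero [Finite F] (P : Matrix o o F) (hP : P.IsSymm)
    (hdet : P.det ≠ 0) :
    Nat.card {p : Matrix o m F × Matrix m m F //
      p.2.IsSymm ∧ (fromBlocks P p.1 p.1ᵀ p.2).det ≠ 0} =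
      Nat.card F ^ (Fintype.card o * Fintype.card m) * Nat.card (SymInv F m) := by
  have hPu : IsUnit P.det := isUnit_iff_ne_zero.2 hdet
  let := P.invertibleOfIsUnitDet hPu
  have e1 : {p : Matrix o m F × Matrix m m F //
      p.2.IsSymm ∧ (fromBlocks P p.1 p.1ᵀ p.2).det ≠ 0} ≃
      {p : Matrix o m F × Matrix m m F // True ∧ (p.2.IsSymm ∧ p.2.det ≠ 0)} := by
    refine (Equiv.prodShear (Equiv.refl _)
      (fun R : Matrix o m F => Equiv.subRight (Rᵀ * ⅟P * R))).subtypeEquiv ?_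
    rintro ⟨R, S⟩
    have hs : (Rᵀ * ⅟P * R).IsSymm := by
      rw [IsSymm, transpose_mul, transpose_mul, transpose_transpose, invOf_eq_nonsing_inv,
        transpose_nonsing_inv, hP.eq, Matrix.mul_assoc]
    simp only [Equiv.prodShear_apply, Equiv.refl_apply, Equiv.subRight_apply, det_fromBlocks₁₁,
      true_and, mul_ne_zero_iff, hdet, ne_eq, not_false_eq_true]
    refine and_congr_left fun _ => ⟨fun h => h.sub hs, fun h => ?_⟩
    simpa using h.add hs
  have e2 : {p : Matrix o m F × Matrix m m F // True ∧ (p.2.IsSymm ∧ p.2.det ≠ 0)} ≃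
      {R : Matrix o m F // True} × SymInv F m :=
    Equiv.subtypeProdEquivProd (p := fun _ : Matrix o m F => True)
      (q := fun S : Matrix m m F => S.IsSymm ∧ S.det ≠ 0)
  rw [Nat.card_congr e1, Nat.card_congr e2, Nat.card_prod,
    Nat.card_congr (Equiv.subtypeUnivEquiv (p := fun _ : Matrix o m F => True) fun _ => trivial),
    natCard_matrix]

/-- The number of invertible symmetric matrices on `1 + m` indices with corner entry `0`. -/
noncomputable def isoCount (F : Type*) [Field F] (m : Type*) [Fintype m] [DecidableEq m] : ℕ :=
  Nat.card {p : Matrix Unit m F × Matrix m m F // p.2.IsSymm ∧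
    (fromBlocks (0 : Matrix Unit Unit F) p.1 p.1ᵀ p.2).det ≠ 0}

/-- Splitting off the first row and column. -/
def symInvEquiv : SymInv F (Unit ⊕ m) ≃ Σ a : Matrix Unit Unit F,
    {p : Matrix Unit m F × Matrix m m F // p.2.IsSymm ∧ (fromBlocks a p.1 p.1ᵀ p.2).det ≠ 0} where
  toFun S := ⟨S.1.toBlocks₁₁, (S.1.toBlocks₁₂, S.1.toBlocks₂₂), by
    obtain ⟨S, hS, hd⟩ := S
    have h21 : S.toBlocks₁₂ᵀ = S.toBlocks₂₁ := by
      ext i j; exact (congrFun (congrFun hS _) _)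
    refine ⟨hS.submatrix Sum.inr, ?_⟩
    simp only
    rwa [h21, fromBlocks_toBlocks]⟩
  invFun x := ⟨fromBlocks x.1 x.2.1.1 x.2.1.1ᵀ x.2.1.2,
    IsSymm.fromBlocks (isSymm_unit _) rfl x.2.2.1, x.2.2.2⟩
  left_inv := by
    rintro ⟨S, hS, hd⟩
    have h21 : S.toBlocks₁₂ᵀ = S.toBlocks₂₁ := by
      ext i j; exact (congrFun (congrFun hS _) _)
    simp only [Subtype.mk.injEq]
    rw [h21, fromBlocks_toBlocks]
  right_inv := by
    rintro ⟨a, ⟨v, S⟩, h⟩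
    rfl

theorem det_unit_ne_zero (a : Matrix Unit Unit F) : a.det ≠ 0 ↔ a ≠ 0 := by
  rw [det_unique, not_iff_not]
  constructor
  · intro h; ext i j; exact h
  · rintro rfl; rfl

/-- The corner entry is nonzero, where the Schur complement applies, or zero, which is counted by
`isoCount`. -/
theorem card_symInv_unit_sum [Finite F] : Nat.card (SymInv F (Unit ⊕ m)) =
    (Nat.card F - 1) * (Nat.card F ^ Fintype.card m * Nat.card (SymInv F m)) + isoCount F m := by
  classical
  have := Fintype.ofFinite F
  rw [Nat.card_congr symInvEquiv, Nat.card_sigma, ← sum_erase_add _ _ (mem_univ 0), isoCount]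
  congr 1
  rw [sum_congr rfl (g := fun _ => Nat.card F ^ Fintype.card m * Nat.card (SymInv F m))]
  · rw [sum_const, card_erase_of_mem (mem_univ _), card_univ, ← Nat.card_eq_fintype_card,
      natCard_matrix]
    simp
  · intro a ha
    rw [card_borderedSymm_of_det_ne_zero a (isSymm_unit a) ((det_unit_ne_zero a).2 (ne_of_mem_erase ha))]
    simp

/-- Replacing row `j` of the identity by `v`, where `v j ≠ 0`, gives determinant `v j`; swapping
rows `i` and `j` then brings `v` to row `i`. -/
theorem exists_GL_vecMul_single_eq (i : m) {v : m → F} (hv : v ≠ 0) :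
    ∃ g : GL m F, Pi.single i 1 ᵥ* (g : Matrix m m F) = v := by
  obtain ⟨j, hj⟩ := Function.ne_iff.1 hv
  have hd : (updateRow (1 : Matrix m m F) j v).det = v j := by
    rw [← cramer_transpose_apply, transpose_one, cramer_one]; rfl
  have hd' : ((updateRow (1 : Matrix m m F) j v).submatrix (Equiv.swap i j) id).det ≠ 0 := by
    rw [det_permute, hd]
    refine mul_ne_zero ?_ hj
    rcases Int.units_eq_one_or (Equiv.Perm.sign (Equiv.swap i j)) with h | h <;> simp [h]
  refine ⟨GeneralLinearGroup.mkOfDetNeZero _ hd', ?_⟩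
  ext k
  simp [GeneralLinearGroup.mkOfDetNeZero]

/-- The congruence action `S ↦ gᵀ S g` of an invertible matrix. -/
def congrEquiv (g : GL m F) : Matrix m m F ≃ Matrix m m F where
  toFun S := (g : Matrix m m F)ᵀ * S * (g : Matrix m m F)
  invFun S := (g⁻¹ : GL m F).valᵀ * S * (g⁻¹ : GL m F).val
  left_inv S := by
    have h1 : g.val * (g⁻¹).val = 1 := by simp
    have h2 : (g⁻¹).valᵀ * g.valᵀ = 1 := by rw [← transpose_mul, h1, transpose_one]
    calc _ = ((g⁻¹).valᵀ * g.valᵀ) * S * (g.val * (g⁻¹).val) := by simp only [mul_assoc]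
      _ = S := by rw [h1, h2, one_mul, mul_one]
  right_inv S := by
    have h1 : (g⁻¹).val * g.val = 1 := by simp
    have h2 : g.valᵀ * (g⁻¹).valᵀ = 1 := by rw [← transpose_mul, h1, transpose_one]
    calc _ = (g.valᵀ * (g⁻¹).valᵀ) * S * ((g⁻¹).val * g.val) := by simp only [mul_assoc]
      _ = S := by rw [h1, h2, one_mul, mul_one]

omit [DecidableEq m] in
theorem isSymm_transpose_mul_mul {S : Matrix m m F} (h : S.IsSymm) (X : Matrix m m F) :
    (Xᵀ * S * X).IsSymm := by
  rw [IsSymm, transpose_mul, transpose_mul, transpose_transpose, h.eq, mul_assoc]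

theorem isSymm_congrEquiv_iff (g : GL m F) (S : Matrix m m F) :
    (congrEquiv g S).IsSymm ↔ S.IsSymm := by
  refine ⟨fun h => ?_, fun h => isSymm_transpose_mul_mul h _⟩
  rw [← (congrEquiv g).symm_apply_apply S]
  exact isSymm_transpose_mul_mul h _

theorem det_GL_ne_zero (g : GL m F) : g.val.det ≠ 0 :=
  ((isUnit_iff_isUnit_det _).1 g.isUnit).ne_zero

theorem det_congrEquiv_ne_zero_iff (g : GL m F) (S : Matrix m m F) :
    (congrEquiv g S).det ≠ 0 ↔ S.det ≠ 0 := by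
  change (_ * _ * _ : Matrix m m F).det ≠ 0 ↔ _
  simp [det_mul, det_GL_ne_zero g]

/-- Congruence by `diag(1, g)` keeps the zero corner and moves the border row, so all nonzero
borders can be reduced to one. -/
theorem card_border_congr (g : GL m F) (u : Matrix Unit m F) :
    Nat.card {S : Matrix m m F // S.IsSymm ∧
      (fromBlocks (0 : Matrix Unit Unit F) (u * g.val) (u * g.val)ᵀ S).det ≠ 0} =
    Nat.card {S : Matrix m m F // S.IsSymm ∧
      (fromBlocks (0 : Matrix Unit Unit F) u uᵀ S).det ≠ 0} := by
  symm
  refine Nat.card_congr ((congrEquiv g).subtypeEquiv fun S => ?_)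
  have hd : fromBlocks 0 (u * g.val) (u * g.val)ᵀ (congrEquiv g S) =
      (fromBlocks 1 0 0 g.val)ᵀ * fromBlocks (0 : Matrix Unit Unit F) u uᵀ S *
        fromBlocks 1 0 0 g.val := by
    simp [fromBlocks_transpose, fromBlocks_multiply, transpose_mul, congrEquiv]
  rw [hd, isSymm_congrEquiv_iff]
  simp [det_mul, det_GL_ne_zero g]

/-- With border `(1, 0)` the first two indices span a hyperbolic plane `P`, which can be split off.
-/
theorem det_bordered_single {S : Matrix (Unit ⊕ m) (Unit ⊕ m) F} (hS : S.IsSymm) :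
    (fromBlocks (0 : Matrix Unit Unit F) (fromCols 1 0) (fromCols 1 0)ᵀ S).det ≠ 0 ↔
      S.toBlocks₂₂.det ≠ 0 := by
  let P : Matrix (Unit ⊕ Unit) (Unit ⊕ Unit) F := fromBlocks 0 1 1 S.toBlocks₁₁
  let P' : Matrix (Unit ⊕ Unit) (Unit ⊕ Unit) F := fromBlocks (-S.toBlocks₁₁) 1 1 0
  have hPP' : P' * P = 1 := by simp [P, P', fromBlocks_multiply]
  let : Invertible P := ⟨P', hPP', mul_eq_one_comm.1 hPP'⟩
  let R : Matrix (Unit ⊕ Unit) m F := fromRows 0 S.toBlocks₁₂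
  have hM : fromBlocks (0 : Matrix Unit Unit F) (fromCols 1 0) (fromCols 1 0)ᵀ S =
      (fromBlocks P R Rᵀ S.toBlocks₂₂).submatrix (Equiv.sumAssoc _ _ _).symm
        (Equiv.sumAssoc _ _ _).symm := by
    ext (i | i | i) (j | j | j) <;> simp [P, R, toBlocks₁₁, toBlocks₁₂, toBlocks₂₂, one_apply]
    exact hS.apply _ _
  -- The Schur correction vanishes: `R` lives in its second row only, and the second diagonal entry
  -- of `P⁻¹` is 0.
  have hR : Rᵀ * ⅟P * R = 0 := by
    change Rᵀ * P' * R = 0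
    simp [R, P', transpose_fromRows, fromCols_mul_fromBlocks, fromCols_mul_fromRows]
  rw [hM, det_submatrix_equiv_self, det_fromBlocks₁₁, hR, sub_zero]
  have : P.det ≠ 0 := (isUnit_det_of_invertible P).ne_zero
  simp [this]

theorem card_border_single [Finite F] :
    Nat.card {S : Matrix (Unit ⊕ m) (Unit ⊕ m) F // S.IsSymm ∧
      (fromBlocks (0 : Matrix Unit Unit F) (fromCols 1 0) (fromCols 1 0)ᵀ S).det ≠ 0} =
    Nat.card F ^ (Fintype.card m + 1) * Nat.card (SymInv F m) := by
  let e : {S : Matrix (Unit ⊕ m) (Unit ⊕ m) F // S.IsSymm ∧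
      (fromBlocks (0 : Matrix Unit Unit F) (fromCols 1 0) (fromCols 1 0)ᵀ S).det ≠ 0} ≃
      Matrix Unit Unit F × Matrix Unit m F × SymInv F m := by
    refine (Equiv.subtypeEquivProp (q := fun S => S.IsSymm ∧ S.toBlocks₂₂.det ≠ 0) ?_).trans ?_
    · funext S
      refine propext (and_congr_right fun hS => ?_)
      exact det_bordered_single hS
    · exact
      { toFun := fun S => (S.1.toBlocks₁₁, S.1.toBlocks₁₂, ⟨S.1.toBlocks₂₂,
          S.2.1.submatrix Sum.inr, S.2.2⟩)
        invFun := fun x => ⟨fromBlocks x.1 x.2.1 x.2.1ᵀ x.2.2.1,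
          IsSymm.fromBlocks (isSymm_unit _) rfl x.2.2.2.1, x.2.2.2.2⟩
        left_inv := by
          rintro ⟨S, hS, hd⟩
          have h21 : S.toBlocks₁₂ᵀ = S.toBlocks₂₁ := by
            ext i j; exact (congrFun (congrFun hS _) _)
          simp only [Subtype.mk.injEq]
          rw [h21, fromBlocks_toBlocks]
        right_inv := by
          rintro ⟨a, v, S⟩
          rfl }
  rw [Nat.card_congr e, Nat.card_prod, Nat.card_prod]
  simp [natCard_matrix, pow_succ]
  ring

/-- A zero border makes the determinant vanish; each of the other borders is equivalent to `(1, 0)`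
and contributes equally. -/
theorem isoCount_unit_sum [Finite F] : isoCount F (Unit ⊕ m) =
    (Nat.card F ^ (Fintype.card m + 1) - 1) *
      (Nat.card F ^ (Fintype.card m + 1) * Nat.card (SymInv F m)) := by
  classical
  have := Fintype.ofFinite F
  let e : {p : Matrix Unit (Unit ⊕ m) F × Matrix (Unit ⊕ m) (Unit ⊕ m) F // p.2.IsSymm ∧
    (fromBlocks (0 : Matrix Unit Unit F) p.1 p.1ᵀ p.2).det ≠ 0} ≃ Σ u : Matrix Unit (Unit ⊕ m) F,
      {S : Matrix (Unit ⊕ m) (Unit ⊕ m) F // S.IsSymm ∧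
        (fromBlocks (0 : Matrix Unit Unit F) u uᵀ S).det ≠ 0} :=
    { toFun := fun p => ⟨p.1.1, p.1.2, p.2⟩
      invFun := fun x => ⟨(x.1, x.2.1), x.2.2⟩
      left_inv := fun _ => rfl
      right_inv := fun _ => rfl }
  rw [isoCount, Nat.card_congr e, Nat.card_sigma, ← sum_erase_add _ _ (mem_univ 0)]
  rw [sum_congr rfl (g := fun _ => Nat.card F ^ (Fintype.card m + 1) * Nat.card (SymInv F m))]
  · rw [sum_const, card_erase_of_mem (mem_univ _), card_univ, ← Nat.card_eq_fintype_card,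
      natCard_matrix]
    have : IsEmpty {S : Matrix (Unit ⊕ m) (Unit ⊕ m) F // S.IsSymm ∧
        (fromBlocks (0 : Matrix Unit Unit F) (0 : Matrix Unit (Unit ⊕ m) F) 0ᵀ S).det ≠ 0} := by
      refine ⟨fun S => S.2.2 ?_⟩
      rw [det_fromBlocks_zero₁₂]
      simp
    rw [Nat.card_of_isEmpty (α := {S : Matrix (Unit ⊕ m) (Unit ⊕ m) F // _}), add_zero]
    simp [add_comm]
  · intro u hu
    have hu' : u () ≠ 0 := by
      intro h
      refine ne_of_mem_erase hu ?_
      ext i j; exact congrFun h j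
    obtain ⟨g, hg⟩ := exists_GL_vecMul_single_eq (Sum.inl ()) hu'
    have : u = (fromCols 1 0 : Matrix Unit (Unit ⊕ m) F) * (g.val : Matrix (Unit ⊕ m) (Unit ⊕ m) F) := by
      have h1 : (fromCols 1 0 : Matrix Unit (Unit ⊕ m) F) =
          replicateRow Unit (Pi.single (Sum.inl ()) 1) := by
        ext i (j | j) <;> simp
      rw [h1, ← replicateRow_vecMul, hg]
      rfl
    rw [this, card_border_congr, card_border_single]

theorem isoCount_of_isEmpty [IsEmpty m] : isoCount F m = 0 := by
  rw [isoCount]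
  have : IsEmpty {p : Matrix Unit m F × Matrix m m F // p.2.IsSymm ∧
      (fromBlocks (0 : Matrix Unit Unit F) p.1 p.1ᵀ p.2).det ≠ 0} := by
    refine ⟨fun S => S.2.2 ?_⟩
    rw [Subsingleton.elim S.1.1 0, det_fromBlocks_zero₁₂]
    simp
  rw [Nat.card_of_isEmpty]

theorem isoCount_congr (e : m ≃ o) : isoCount F m = isoCount F o := by
  refine Nat.card_congr (((reindex (Equiv.refl _) e).prodCongr (reindex e e)).subtypeEquiv
    fun p => ?_)
  have h : fromBlocks (0 : Matrix Unit Unit F) p.1 p.1ᵀ p.2 =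
    (fromBlocks (0 : Matrix Unit Unit F) (reindex (Equiv.refl _) e p.1)
      (reindex (Equiv.refl _) e p.1)ᵀ (reindex e e p.2)).submatrix
      (Equiv.sumCongr (Equiv.refl _) e) (Equiv.sumCongr (Equiv.refl _) e) := by
    ext (i | i) (j | j) <;> simp
  simp only [Equiv.prodCongr_apply, Prod.map]
  rw [h, det_submatrix_equiv_self]
  refine and_congr_left fun _ => ?_
  constructor
  · intro h; exact h.submatrix _
  · intro h; simpa using h.submatrix e

/-- The number of invertible symmetric matrices for which a given nonzero vector is isotropic. -/
theorem card_symInv_isotropic {v : Unit ⊕ m → F} (hv : v ≠ 0) :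
    Nat.card {S : SymInv F (Unit ⊕ m) // v ⬝ᵥ S.1 *ᵥ v = 0} = isoCount F m := by
  obtain ⟨g, hg⟩ := exists_GL_vecMul_single_eq (Sum.inl ()) hv
  -- The transpose is needed because `v = e g` gives `v S ᵗv = e (g S ᵗg) ᵗe`, which is the corner
  -- entry of the congruence of `S` by `ᵗg`.
  let gt : GL (Unit ⊕ m) F := ⟨g.valᵀ, (g⁻¹).valᵀ, by rw [← transpose_mul]; simp,
    by rw [← transpose_mul]; simp⟩
  let e : SymInv F (Unit ⊕ m) ≃ SymInv F (Unit ⊕ m) := (congrEquiv gt).subtypeEquiv fun S => by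
    rw [isSymm_congrEquiv_iff, det_congrEquiv_ne_zero_iff]
  have he : ∀ S, v ⬝ᵥ S.1 *ᵥ v = 0 ↔ (e S).1.toBlocks₁₁ = 0 := by
    intro S
    have h1 : v ⬝ᵥ S.1 *ᵥ v = (e S).1 (Sum.inl ()) (Sum.inl ()) := by
      change _ = (g.valᵀᵀ * S.1 * g.valᵀ) _ _
      rw [← hg, transpose_transpose]
      rw [← dotProduct_mulVec, mulVec_mulVec, ← mulVec_transpose (A := g.val), mulVec_mulVec,
        single_one_dotProduct, mulVec_single_one]
      simp only [mul_assoc]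
      rfl
    rw [h1]
    constructor
    · intro h; ext i j; exact h
    · intro h; exact congrFun (congrFun h ()) ()
  rw [Nat.card_congr (e.subtypeEquiv (q := fun S => S.1.toBlocks₁₁ = 0) he), isoCount]
  refine Nat.card_congr ((symInvEquiv.subtypeEquiv (q := fun x => x.1 = 0) fun S => Iff.rfl).trans ?_)
  exact
    { toFun := fun x => ⟨x.1.2.1, by
        obtain ⟨⟨a, p, hp⟩, h⟩ := x
        change a = 0 at h
        subst h
        exact hp⟩
      invFun := fun p => ⟨⟨0, p⟩, rfl⟩
      left_inv := by
        rintro ⟨⟨a, p⟩, h⟩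
        change a = 0 at h
        subst h
        rfl
      right_inv := fun _ => rfl }

end Symm

/-! ### Closed formulas for invertible symmetric matrices and for the values of their quadratic
forms -/

section SymmFormulas

open Matrix

variable {F : Type*} [Field F] [Finite F]

/-- An equivalence splitting off one index. -/
def unitSumFinEquiv (r : ℕ) : Unit ⊕ Fin r ≃ Fin (r + 1) :=
  (Equiv.sumCongr finOneEquiv.symm (Equiv.refl _)).trans
    (finSumFinEquiv.trans (finCongr (add_comm 1 r)))

theorem one_le_natCard_pow (r : ℕ) : 1 ≤ Nat.card F ^ r := Nat.one_le_pow _ _ Nat.card_pos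

theorem card_symInv_succ (r : ℕ) : (Nat.card (SymInv F (Fin (r + 1))) : ℚ) =
    (Nat.card F - 1) * (Nat.card F ^ r * Nat.card (SymInv F (Fin r))) + isoCount F (Fin r) := by
  rw [← card_symInv_congr (unitSumFinEquiv r), card_symInv_unit_sum]
  push_cast [Nat.cast_sub (Nat.card_pos (α := F))]
  simp

theorem isoCount_succ (r : ℕ) : (isoCount F (Fin (r + 1)) : ℚ) =
    ((Nat.card F : ℚ) ^ (r + 1) - 1) *
      ((Nat.card F : ℚ) ^ (r + 1) * Nat.card (SymInv F (Fin r))) := by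
  rw [← isoCount_congr (unitSumFinEquiv r), isoCount_unit_sum, Fintype.card_fin]
  push_cast [Nat.cast_sub (one_le_natCard_pow (F := F) (r + 1))]
  rfl

omit [Finite F] in
theorem card_symInv_zero : Nat.card (SymInv F (Fin 0)) = 1 := by
  rw [Nat.card_eq_one_iff_unique]
  exact ⟨inferInstance, ⟨⟨0, by ext i; exact i.elim0, by simp⟩⟩⟩

/-- The recursion goes back two sizes, through `isoCount`, so the two parities are proved together.
-/
theorem card_symInv_odd_even (m : ℕ) :
    (Nat.card (SymInv F (Fin (2 * m + 1))) : ℚ) =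
      ((Nat.card F : ℚ) ^ (2 * m + 1) - 1) * Nat.card (SymInv F (Fin (2 * m))) ∧
    (Nat.card (SymInv F (Fin (2 * m + 2))) : ℚ) =
      (Nat.card F : ℚ) ^ (2 * m + 2) * Nat.card (SymInv F (Fin (2 * m + 1))) := by
  induction m with
  | zero =>
    have h1 : (Nat.card (SymInv F (Fin (2 * 0 + 1))) : ℚ) =
      ((Nat.card F : ℚ) ^ (2 * 0 + 1) - 1) * Nat.card (SymInv F (Fin (2 * 0))) := by
      have : IsEmpty (Fin (2 * 0)) := inferInstanceAs (IsEmpty (Fin 0))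
      rw [card_symInv_succ, isoCount_of_isEmpty]
      simp [card_symInv_zero]
    refine ⟨h1, ?_⟩
    rw [card_symInv_succ, isoCount_succ, h1]
    ring
  | succ m ih =>
    have h1 : (Nat.card (SymInv F (Fin (2 * (m + 1) + 1))) : ℚ) =
        ((Nat.card F : ℚ) ^ (2 * (m + 1) + 1) - 1) * Nat.card (SymInv F (Fin (2 * (m + 1)))) := by
      rw [card_symInv_succ, show 2 * (m + 1) = 2 * m + 1 + 1 by ring, isoCount_succ]
      rw [show 2 * m + 1 + 1 = 2 * m + 2 by ring, ih.2]
      ring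
    refine ⟨h1, ?_⟩
    rw [show 2 * (m + 1) + 2 = 2 * (m + 1) + 1 + 1 by ring, card_symInv_succ, isoCount_succ, h1]
    ring

theorem card_symInv_two_mul (m : ℕ) : (Nat.card (SymInv F (Fin (2 * m))) : ℚ) =
    (Nat.card F : ℚ) ^ (m * (m + 1)) * ∏ j ∈ Icc 1 m, ((Nat.card F : ℚ) ^ (2 * j - 1) - 1) := by
  induction m with
  | zero => simp [card_symInv_zero]
  | succ m ih =>
    rw [mul_add, mul_one, (card_symInv_odd_even m).2, (card_symInv_odd_even m).1, ih,
      prod_Icc_succ_top (by omega), show 2 * (m + 1) - 1 = 2 * m + 1 by omega]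
    ring

/-- In even size exactly one in `q` of the invertible symmetric matrices has corner entry 0. This is
the point where the evenness of `r` matters. -/
theorem card_mul_isoCount (m : ℕ) : (Nat.card F : ℚ) * isoCount F (Fin (2 * m + 1)) =
    Nat.card (SymInv F (Fin (2 * m + 2))) := by
  rw [isoCount_succ, (card_symInv_odd_even m).2, (card_symInv_odd_even m).1]
  ring

theorem natCard_subtype_prod {X Y : Type*} [Finite X] [Finite Y] (P : X → Y → Prop) :
    Nat.card {p : X × Y // P p.1 p.2} = ∑ᶠ y, Nat.card {x // P x y} := by
  have := Fintype.ofFinite Y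
  let e : {p : X × Y // P p.1 p.2} ≃ Σ y, {x // P x y} :=
    { toFun := fun p => ⟨p.1.2, p.1.1, p.2⟩
      invFun := fun x => ⟨(x.2.1, x.1), x.2.2⟩
      left_inv := fun _ => rfl
      right_inv := fun _ => rfl }
  rw [Nat.card_congr e, Nat.card_sigma, finsum_eq_sum_of_fintype]

/-- The number of pairs `(S, v)`, `S` invertible symmetric, with `v S ᵗv = c`. -/
noncomputable def quadCount {F : Type*} [Field F] (r : ℕ) (c : F) : ℕ :=
  Nat.card {p : SymInv F (Fin r) × (Fin r → F) // p.2 ⬝ᵥ p.1.1 *ᵥ p.2 = c}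

/-- The zero vector is isotropic for every `S`, and each nonzero vector for a fraction `1/q` of
them. -/
theorem quadCount_zero_of_even (m : ℕ) : (Nat.card F : ℚ) * quadCount (2 * m) (0 : F) =
    Nat.card (SymInv F (Fin (2 * m))) * ((Nat.card F : ℚ) ^ (2 * m) + Nat.card F - 1) := by
  classical
  have := Fintype.ofFinite F
  rw [quadCount, natCard_subtype_prod (fun (S : SymInv F (Fin (2 * m))) (v : Fin (2 * m) → F) => v ⬝ᵥ S.1 *ᵥ v = 0),
    finsum_eq_sum_of_fintype, ← sum_erase_add _ _ (mem_univ 0)]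
  have h0 : Nat.card {S : SymInv F (Fin (2 * m)) // (0 : Fin (2 * m) → F) ⬝ᵥ S.1 *ᵥ 0 = 0} =
      Nat.card (SymInv F (Fin (2 * m))) :=
    Nat.card_congr (Equiv.subtypeUnivEquiv fun _ => by simp)
  rw [h0]
  cases m with
  | zero =>
    have : IsEmpty (Fin (2 * 0)) := inferInstanceAs (IsEmpty (Fin 0))
    have : (univ.erase (0 : Fin (2 * 0) → F)) = ∅ := by
      ext v; simp [Subsingleton.elim v 0]
    rw [this]
    simp; ring
  | succ m =>
    rw [sum_congr rfl (g := fun _ => isoCount F (Fin (2 * m + 1)))]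
    · rw [sum_const, card_erase_of_mem (mem_univ _), card_univ, smul_eq_mul, Fintype.card_fun,
        Fintype.card_fin, ← Nat.card_eq_fintype_card]
      push_cast [Nat.cast_sub (one_le_natCard_pow (F := F) (2 * (m + 1)))]
      rw [mul_add]
      have := card_mul_isoCount (F := F) m
      rw [mul_left_comm, this, mul_add 2 m 1, mul_one]
      ring
    · intro v hv
      let e := unitSumFinEquiv (2 * m + 1)
      have hv' : v ∘ e ≠ 0 := by
        intro h
        refine ne_of_mem_erase hv ?_
        funext i
        simpa using congrFun h (e.symm i)
      rw [← card_symInv_isotropic hv']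
      let f : SymInv F (Fin (2 * (m + 1))) ≃ SymInv F (Unit ⊕ Fin (2 * m + 1)) :=
        (reindex e.symm e.symm).subtypeEquiv fun S => by
          rw [reindex_apply, det_submatrix_equiv_self]
          refine and_congr_left fun _ => ?_
          constructor
          · intro h; exact h.submatrix _
          · intro h; simpa using h.submatrix e.symm
      refine Nat.card_congr (f.subtypeEquiv fun S => ?_)
      have : (v ∘ e) ⬝ᵥ (f S).1 *ᵥ (v ∘ e) = v ⬝ᵥ S.1 *ᵥ v := by
        change (v ∘ e) ⬝ᵥ (S.1.submatrix e.symm.symm e.symm.symm) *ᵥ (v ∘ e) = _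
        rw [Equiv.symm_symm, submatrix_mulVec_equiv, comp_equiv_dotProduct_comp_equiv]
        simp [Function.comp_assoc]
      rw [this]

omit [Finite F] in
-- Scaling `S` by `c` preserves symmetry and invertibility and multiplies the value by `c`.
theorem quadCount_eq_of_ne_zero (r : ℕ) {c : F} (hc : c ≠ 0) : quadCount r c = quadCount r (1 : F) := by
  symm
  let e : SymInv F (Fin r) ≃ SymInv F (Fin r) :=
    { toFun := fun S => ⟨c • S.1, S.2.1.smul c, by
        rw [det_smul]; exact mul_ne_zero (pow_ne_zero _ hc) S.2.2⟩
      invFun := fun S => ⟨c⁻¹ • S.1, S.2.1.smul _, by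
        rw [det_smul]; exact mul_ne_zero (pow_ne_zero _ (inv_ne_zero hc)) S.2.2⟩
      left_inv := fun S => by simp [smul_smul, hc]
      right_inv := fun S => by simp [smul_smul, hc] }
  refine Nat.card_congr ((e.prodCongr (Equiv.refl _)).subtypeEquiv fun p => ?_)
  change _ ↔ p.2 ⬝ᵥ (c • p.1.1) *ᵥ p.2 = c
  rw [smul_mulVec, dotProduct_smul, smul_eq_mul]
  constructor
  · intro h; rw [h, mul_one]
  · intro h; exact mul_left_cancel₀ hc (by rw [h, mul_one])

theorem sum_quadCount [Fintype F] (r : ℕ) : ∑ c : F, (quadCount r c : ℚ) =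
    Nat.card (SymInv F (Fin r)) * (Nat.card F : ℚ) ^ r := by
  have h := Nat.card_congr (Equiv.sigmaFiberEquiv
    fun p : SymInv F (Fin r) × (Fin r → F) => p.2 ⬝ᵥ p.1.1 *ᵥ p.2)
  rw [Nat.card_sigma, Nat.card_prod, Nat.card_fun, Nat.card_fin] at h
  exact_mod_cast h

/-- The nonzero values share equally what the value 0 leaves, so only the term from `v = 0` depends
on `c`. -/
theorem quadCount_of_even [DecidableEq F] (m : ℕ) (c : F) :
    (Nat.card F : ℚ) * quadCount (2 * m) c = Nat.card (SymInv F (Fin (2 * m))) *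
      ((Nat.card F : ℚ) ^ (2 * m) - 1 + if c = 0 then (Nat.card F : ℚ) else 0) := by
  have := Fintype.ofFinite F
  split_ifs with h
  · rw [h, quadCount_zero_of_even]; ring
  · have h1 := sum_quadCount (F := F) (2 * m)
    rw [← sum_erase_add _ _ (mem_univ 0), sum_congr rfl (g := fun _ => (quadCount (2 * m) c : ℚ)),
      sum_const, card_erase_of_mem (mem_univ _), card_univ, ← Nat.card_eq_fintype_card,
      nsmul_eq_mul, Nat.cast_sub Nat.card_pos] at h1
    · have h2 := quadCount_zero_of_even (F := F) m
      have h3 : (1 : ℚ) < Nat.card F := by exact_mod_cast Finite.one_lt_card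
      push_cast at h1
      have h4 : ((Nat.card F : ℚ) - 1) ≠ 0 := by linarith
      apply mul_left_cancel₀ h4
      linear_combination (Nat.card F : ℚ) * h1 - h2
    · intro d hd
      rw [quadCount_eq_of_ne_zero _ h, quadCount_eq_of_ne_zero _ (ne_of_mem_erase hd)]

end SymmFormulas

/-! ### Skew-symmetric matrices -/

section SkewSymm

open Matrix

variable {F : Type*} [Field F] {m o : Type*}

theorem two_ne_zero_of_three_eq_zero (h3 : (3 : F) = 0) : (2 : F) ≠ 0 := by
  intro h
  have : (1 : F) = 3 - 2 := by norm_num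
  rw [h, h3, sub_zero] at this
  exact one_ne_zero this

/-- Skew-symmetric matrices in block form. -/
def skewSumEquiv : Skew F (o ⊕ m) ≃ Skew F o × Matrix o m F × Skew F m where
  toFun K := (⟨K.1.toBlocks₁₁, by ext i j; exact congrFun (congrFun K.2 (Sum.inl i)) (Sum.inl j)⟩,
    K.1.toBlocks₁₂,
    ⟨K.1.toBlocks₂₂, by ext i j; exact congrFun (congrFun K.2 (Sum.inr i)) (Sum.inr j)⟩)
  invFun x := ⟨fromBlocks x.1.1 x.2.1 (-x.2.1ᵀ) x.2.2.1, by
    rw [fromBlocks_transpose, fromBlocks_add, x.1.2, x.2.2.2]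
    simp⟩
  left_inv K := by
    have h : -K.1.toBlocks₁₂ᵀ = K.1.toBlocks₂₁ := by
      ext i j
      have := congrFun (congrFun K.2 (Sum.inr i)) (Sum.inl j)
      exact (eq_neg_of_add_eq_zero_left this).symm
    apply Subtype.ext
    simp only
    rw [h, fromBlocks_toBlocks]
  right_inv x := rfl

theorem card_skew_congr (e : m ≃ o) : Nat.card (Skew F m) = Nat.card (Skew F o) := by
  refine Nat.card_congr ((reindex e e).subtypeEquiv fun K => ?_)
  constructor
  · intro h
    exact congrArg (reindex e e) h
  · intro h
    exact (reindex e e).injective h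

theorem card_skew_sum [Finite F] [Fintype m] [Fintype o] : Nat.card (Skew F (o ⊕ m)) =
    Nat.card (Skew F o) * (Nat.card F ^ (Fintype.card o * Fintype.card m) * Nat.card (Skew F m)) := by
  rw [Nat.card_congr skewSumEquiv, Nat.card_prod, Nat.card_prod, natCard_matrix]

theorem card_skew_toBlocks₁₁_eq_zero [Finite F] [Fintype m] [Fintype o] :
    Nat.card {K : Skew F (o ⊕ m) // K.1.toBlocks₁₁ = 0} =
      Nat.card F ^ (Fintype.card o * Fintype.card m) * Nat.card (Skew F m) := by
  have e : {K : Skew F (o ⊕ m) // K.1.toBlocks₁₁ = 0} ≃ Matrix o m F × Skew F m :=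
    { toFun := fun K => (skewSumEquiv K.1).2
      invFun := fun x => ⟨skewSumEquiv.symm (⟨0, by simp⟩, x), rfl⟩
      left_inv := fun K => by
        apply Subtype.ext
        simp only
        rw [Equiv.symm_apply_eq]
        exact Prod.ext (Subtype.ext K.2.symm) rfl
      right_inv := fun x => rfl }
  rw [Nat.card_congr e, Nat.card_prod, natCard_matrix]

/-- Since 2 is invertible, the diagonal of a skew matrix vanishes and the entries above it are free.
-/
theorem card_skew_fin [Finite F] (h3 : (3 : F) = 0) (n : ℕ) :
    Nat.card (Skew F (Fin n)) = Nat.card F ^ (n.choose 2) := by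
  induction n with
  | zero =>
    rw [Nat.choose_zero_succ, pow_zero, Nat.card_eq_one_iff_unique]
    exact ⟨inferInstance, ⟨⟨0, by simp⟩⟩⟩
  | succ n ih =>
    have h1 : Nat.card (Skew F Unit) = 1 := by
      rw [Nat.card_eq_one_iff_unique]
      refine ⟨⟨fun K K' => ?_⟩, ⟨⟨0, by simp⟩⟩⟩
      have key : ∀ K : Skew F Unit, K.1 = 0 := by
        intro K
        ext i j
        have h : K.1 i j + K.1 i j = 0 := congrFun (congrFun K.2 i) j
        rw [← two_mul] at h
        exact (mul_eq_zero.1 h).resolve_left (two_ne_zero_of_three_eq_zero h3)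
      exact Subtype.ext ((key K).trans (key K').symm)
    rw [← card_skew_congr (unitSumFinEquiv n), card_skew_sum, h1, ih, Nat.choose_succ_succ]
    simp [pow_add]

variable [Fintype m] [DecidableEq m]

omit [DecidableEq m] in
-- Transposing shows that the trace equals its own negative.
theorem trace_mul_skew_of_isSymm (h3 : (3 : F) = 0) {M : Matrix m m F} (hM : M.IsSymm)
    (K : Skew F m) : trace (M * K.1) = 0 := by
  have h : trace (M * K.1) = -trace (M * K.1) := by
    conv_lhs => rw [← trace_transpose, transpose_mul, hM.eq, eq_neg_of_add_eq_zero_right K.2,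
      neg_mul, trace_neg, trace_mul_comm]
  have h' : 2 * trace (M * K.1) = 0 := by linear_combination h
  exact (mul_eq_zero.1 h').resolve_left (two_ne_zero_of_three_eq_zero h3)

/-- A nonzero linear form on a finite space takes every value equally often; here the fibres are
compared by translating `K`. -/
theorem card_skew_trace_eq [Finite F] {M : Matrix m m F} (hM : ¬ M.IsSymm) (c : F) :
    Nat.card F * Nat.card {K : Skew F m // trace (M * K.1) = c} = Nat.card (Skew F m) := by
  classical
  have := Fintype.ofFinite F
  obtain ⟨i, j, hij⟩ : ∃ i j, M i j ≠ M j i := by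
    by_contra! h
    exact hM (IsSymm.ext fun i j => h j i)
  have hd : M i j - M j i ≠ 0 := sub_ne_zero.2 hij
  -- An elementary skew matrix on which the form takes the nonzero value `M i j - M j i`.
  let K₀ : Matrix m m F := single j i 1 - single i j 1
  have hK₀ : K₀ + K₀ᵀ = 0 := by simp [K₀]
  have htr : trace (M * K₀) = M i j - M j i := by
    rw [mul_sub, trace_sub, trace_mul_single, trace_mul_single]
    simp
  have hconst : ∀ c : F, Nat.card {K : Skew F m // trace (M * K.1) = c} =
      Nat.card {K : Skew F m // trace (M * K.1) = 0} := by
    intro c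
    symm
    let K₁ : Matrix m m F := (c / (M i j - M j i)) • K₀
    have hK₁ : K₁ + K₁ᵀ = 0 := by rw [transpose_smul, ← smul_add, hK₀, smul_zero]
    have htr₁ : trace (M * K₁) = c := by
      rw [mul_smul_comm, trace_smul, htr, smul_eq_mul, div_mul_cancel₀ _ hd]
    let e : Skew F m ≃ Skew F m :=
      { toFun := fun K => ⟨K.1 + K₁, by rw [transpose_add, add_add_add_comm, K.2, hK₁, add_zero]⟩
        invFun := fun K => ⟨K.1 - K₁, by
          rw [transpose_sub, sub_add_sub_comm, K.2, hK₁, sub_zero]⟩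
        left_inv := fun K => by simp
        right_inv := fun K => by simp }
    refine Nat.card_congr (e.subtypeEquiv fun K => ?_)
    change _ ↔ trace (M * (K.1 + K₁)) = c
    rw [mul_add, trace_add, htr₁, add_eq_right]
  have h := Nat.card_congr (Equiv.sigmaFiberEquiv fun K : Skew F m => trace (M * K.1))
  rw [Nat.card_sigma, sum_congr rfl fun c _ => hconst c, sum_const, card_univ, smul_eq_mul,
    ← Nat.card_eq_fintype_card] at h
  rw [hconst, h]

end SkewSymm

/-! ### Block lower triangular invertible matrices -/

section BlockLower

open Matrix

variable {F : Type*} [Field F] {m o : Type*} [Fintype m] [DecidableEq m] [Fintype o] [DecidableEq o]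

/-- The invertible matrix with diagonal blocks `S`, `T` and lower left block `C`. -/
def blockLower (x : GL o F × Matrix m o F × GL m F) : GL (o ⊕ m) F where
  val := fromBlocks x.1.val 0 x.2.1 x.2.2.val
  inv := fromBlocks (x.1⁻¹).val 0 (-((x.2.2⁻¹).val * x.2.1 * (x.1⁻¹).val)) (x.2.2⁻¹).val
  val_inv := by
    have h : x.2.2.val * ((x.2.2⁻¹).val * x.2.1 * (x.1⁻¹).val) = x.2.1 * (x.1⁻¹).val := by
      rw [← Matrix.mul_assoc, ← Matrix.mul_assoc, Units.mul_inv, Matrix.one_mul]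
    rw [fromBlocks_multiply, Matrix.mul_neg x.2.2.val, h]
    simp only [Matrix.mul_neg, neg_zero, Units.mul_inv, Matrix.zero_mul, Matrix.mul_zero, add_zero, zero_add, add_neg_cancel,
      fromBlocks_one]
  inv_val := by
    have h : (x.2.2⁻¹).val * x.2.1 * (x.1⁻¹).val * x.1.val = (x.2.2⁻¹).val * x.2.1 := by
      rw [Matrix.mul_assoc, Units.inv_mul, Matrix.mul_one]
    rw [fromBlocks_multiply, Matrix.neg_mul, h]
    simp only [Units.inv_mul, Matrix.zero_mul, Matrix.mul_zero, add_zero, zero_add, neg_add_cancel,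
      fromBlocks_one]

theorem blockLower_injective : Function.Injective (blockLower (F := F) (m := m) (o := o)) := by
  rintro ⟨S, C, T⟩ ⟨S', C', T'⟩ h
  have h' := congrArg Units.val h
  simp only [blockLower] at h'
  rw [fromBlocks_inj] at h'
  obtain ⟨hS, -, hC, hT⟩ := h'
  rw [Units.ext hS, hC, Units.ext hT]

/-- Reading `A A⁻¹ = 1` in the first diagonal block and `A⁻¹ A = 1` in the second shows that both
diagonal blocks of `A` are invertible. -/
theorem exists_blockLower_eq {A : GL (o ⊕ m) F} (hA : A.val.toBlocks₁₂ = 0) :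
    ∃ x, blockLower x = A := by
  have h1 : A.val.toBlocks₁₁ * (A⁻¹).val.toBlocks₁₁ = 1 := by
    have h := A.mul_inv
    rw [← fromBlocks_toBlocks A.val, ← fromBlocks_toBlocks (A⁻¹).val, fromBlocks_multiply,
      ← fromBlocks_one, fromBlocks_inj, hA, Matrix.zero_mul, add_zero] at h
    exact h.1
  have h2 : (A⁻¹).val.toBlocks₂₂ * A.val.toBlocks₂₂ = 1 := by
    have h := A.inv_mul
    rw [← fromBlocks_toBlocks A.val, ← fromBlocks_toBlocks (A⁻¹).val, fromBlocks_multiply,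
      ← fromBlocks_one, fromBlocks_inj, hA] at h
    simpa using h.2.2.2
  refine ⟨(⟨_, _, h1, mul_eq_one_comm.1 h1⟩, A.val.toBlocks₂₁, ⟨_, _, mul_eq_one_comm.1 h2, h2⟩), ?_⟩
  apply Units.ext
  simp only [blockLower]
  rw [← hA, fromBlocks_toBlocks]

theorem card_GL_toBlocks₁₂_eq_zero [Finite F] :
    Nat.card {A : GL (o ⊕ m) F // A.val.toBlocks₁₂ = 0} = Nat.card (GL o F) *
      (Nat.card F ^ (Fintype.card m * Fintype.card o) * Nat.card (GL m F)) := by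
  have e : GL o F × Matrix m o F × GL m F ≃ {A : GL (o ⊕ m) F // A.val.toBlocks₁₂ = 0} :=
    Equiv.ofBijective (fun x => ⟨blockLower x, by simp [blockLower]⟩)
      ⟨fun x y h => blockLower_injective (congrArg Subtype.val h), fun A => by
        obtain ⟨x, hx⟩ := exists_blockLower_eq A.2
        exact ⟨x, Subtype.ext hx⟩⟩
  rw [← Nat.card_congr e, Nat.card_prod, Nat.card_prod, natCard_matrix]

theorem card_GL_congr (e : m ≃ o) : Nat.card (GL m F) = Nat.card (GL o F) :=
  Nat.card_congr (Units.mapEquiv (reindexAlgEquiv F F e).toMulEquiv).toEquiv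

end BlockLower

/-! ### The numbers of elements of `Q`, of its stabilizer of `σ_r`, and of given trace in `Q σ_r` -/

section Counts

open Matrix

variable {F : Type*} [Field F] [Finite F]

/-- The number of `T ∈ GL(k, F)` with `Tr T + Tr T⁻¹ = c`. -/
noncomputable def glTraceCount {F : Type*} [Field F] (k : ℕ) (c : F) : ℕ :=
  Nat.card {T : GL (Fin k) F // trace T.val + trace (T⁻¹).val = c}

theorem ncard_Q (h3 : (3 : F) = 0) (r k : ℕ) : (Q F (r + k)).ncard =
    Nat.card (GL (Fin (r + k)) F) * (Nat.card F ^ (r + k).choose 2 * Nat.card F ^ (r + k)) := by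
  have h := ncard_Q_filter h3 r k fun _ => True
  have e : {w | w ∈ Q F (r + k) ∧ True} = Q F (r + k) := by ext; simp
  have e' : {t : GL (Fin r ⊕ Fin k) F × Skew F (Fin r ⊕ Fin k) × (Fin r ⊕ Fin k → F) | True} =
      Set.univ := by ext; simp
  rw [e, e', Set.ncard_univ, Nat.card_prod, Nat.card_prod, card_GL_congr finSumFinEquiv,
    card_skew_congr finSumFinEquiv, card_skew_fin h3, Nat.card_fun, Nat.card_sum, Nat.card_fin,
    Nat.card_fin] at h
  exact h

/-- The three conditions on `A`, `K` and `v` are independent, so the count is a product. -/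
theorem ncard_stabilizer (h3 : (3 : F) = 0) (r k : ℕ) :
    {x | x ∈ Q F (r + k) ∧ sigma F (r + k) r * x * sigma F (r + k) r ∈ Q F (r + k)}.ncard =
      Nat.card (GL (Fin r) F) * (Nat.card F ^ (k * r) * Nat.card (GL (Fin k) F)) *
        (Nat.card F ^ (r * k) * Nat.card F ^ k.choose 2 * Nat.card F ^ k) := by
  rw [ncard_Q_filter h3]
  have h1 : {t : GL (Fin r ⊕ Fin k) F × Skew F (Fin r ⊕ Fin k) × (Fin r ⊕ Fin k → F) |
      sigma F (r + k) r * qMat t * sigma F (r + k) r ∈ Q F (r + k)} =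
      {A | A.val.toBlocks₁₂ = 0} ×ˢ ({K | K.1.toBlocks₁₁ = 0} ×ˢ {v | ∀ i, v (Sum.inl i) = 0}) := by
    ext ⟨A, K, v⟩
    exact sigma_conj_qMat_mem_Q_iff h3 A K v
  have hv : {v : Fin r ⊕ Fin k → F | ∀ i, v (Sum.inl i) = 0}.ncard = Nat.card F ^ k := by
    rw [← Nat.card_coe_set_eq]
    let e : {v : Fin r ⊕ Fin k → F | ∀ i, v (Sum.inl i) = 0} ≃ (Fin k → F) :=
      { toFun := fun v => v.1 ∘ Sum.inr
        invFun := fun w => ⟨Sum.elim 0 w, fun i => rfl⟩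
        left_inv := fun v => by
          apply Subtype.ext
          funext i
          rcases i with i | i
          · exact (v.2 i).symm
          · rfl
        right_inv := fun w => rfl }
    rw [Nat.card_congr e, Nat.card_fun, Nat.card_fin]
  have hA := card_GL_toBlocks₁₂_eq_zero (F := F) (m := Fin k) (o := Fin r)
  have hK := card_skew_toBlocks₁₁_eq_zero (F := F) (m := Fin k) (o := Fin r)
  rw [Fintype.card_fin, Fintype.card_fin] at hA hK
  rw [card_skew_fin h3] at hK
  rw [h1, Set.ncard_prod, Set.ncard_prod, hv, ← Nat.card_coe_set_eq, ← Nat.card_coe_set_eq]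
  change Nat.card {A : GL (Fin r ⊕ Fin k) F // A.val.toBlocks₁₂ = 0} *
    (Nat.card {K : Skew F (Fin r ⊕ Fin k) // K.1.toBlocks₁₁ = 0} * _) = _
  rw [hA, hK]

omit [Finite F] in
-- The projection kills the lower rows, so symmetry forces the upper right block to vanish as well.
theorem isSymm_head_mul_iff {r k : ℕ} (A : Matrix (Fin r ⊕ Fin k) (Fin r ⊕ Fin k) F) :
    (fromBlocks 1 0 0 0 * A : Matrix (Fin r ⊕ Fin k) (Fin r ⊕ Fin k) F).IsSymm ↔
      A.toBlocks₁₂ = 0 ∧ A.toBlocks₁₁.IsSymm := by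
  have h : (fromBlocks 1 0 0 0 * A : Matrix (Fin r ⊕ Fin k) (Fin r ⊕ Fin k) F) =
      fromBlocks A.toBlocks₁₁ A.toBlocks₁₂ 0 0 := by
    conv_lhs => rw [← fromBlocks_toBlocks A, fromBlocks_multiply]
    simp
  rw [h, isSymm_fromBlocks_iff]
  constructor
  · rintro ⟨h1, h2, -⟩
    refine ⟨?_, h1⟩
    rw [← transpose_transpose A.toBlocks₁₂, h2, transpose_zero]
  · rintro ⟨h1, h2⟩
    exact ⟨h2, by simp [h1], by simp [h1], isSymm_zero⟩

/-- This is the dichotomy behind the trace count: the uniform value is 1, and only a symmetric `M`,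
whose form vanishes on skew matrices, contributes a correction. -/
theorem card_skew_trace_shift [DecidableEq F] (h3 : (3 : F) = 0) {m : Type*} [Fintype m]
    [DecidableEq m] (M : Matrix m m F) [Decidable M.IsSymm] (a β : F) :
    (Nat.card F : ℚ) * Nat.card {K : Skew F m // trace (M * K.1) + a = β} =
      Nat.card (Skew F m) * (1 + if M.IsSymm then
        ((Nat.card F : ℚ) * (if a = β then 1 else 0) - 1) else 0) := by
  split_ifs with hM ha
  · have h : Nat.card {K : Skew F m // trace (M * K.1) + a = β} = Nat.card (Skew F m) :=
      Nat.card_congr (Equiv.subtypeUnivEquiv fun K => by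
        rw [trace_mul_skew_of_isSymm h3 hM, zero_add, ha])
    rw [h]; ring
  · have : IsEmpty {K : Skew F m // trace (M * K.1) + a = β} :=
      ⟨fun K => ha (by rw [← K.2, trace_mul_skew_of_isSymm h3 hM, zero_add])⟩
    rw [Nat.card_of_isEmpty (α := {K : Skew F m // _})]; push_cast; ring
  · have h : Nat.card {K : Skew F m // trace (M * K.1) + a = β} =
        Nat.card {K : Skew F m // trace (M * K.1) = β - a} :=
      Nat.card_congr (Equiv.subtypeEquivRight fun K => eq_sub_iff_add_eq.symm)
    rw [h, add_zero, mul_one]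
    exact_mod_cast card_skew_trace_eq hM (β - a)

theorem sum_ite_eq_card {X : Type*} [Fintype X] (P : X → Prop) [DecidablePred P] (a b : ℚ) :
    ∑ x, (a * (if P x then 1 else 0) - b) = a * Nat.card {x // P x} - b * Nat.card X := by
  rw [sum_sub_distrib, ← mul_sum, sum_boole, Nat.card_eq_fintype_card, Nat.card_eq_fintype_card,
    Fintype.card_subtype, sum_const, card_univ, nsmul_eq_mul, mul_comm b]

/-- The constant part of `Tr (x σ_r)`, once the skew-symmetric part of `x` is left out. -/
noncomputable def shift {r k : ℕ} (A : GL (Fin r ⊕ Fin k) F) (v : Fin r ⊕ Fin k → F) : F :=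
  trace A.val.toBlocks₂₂ + trace (A⁻¹).val.toBlocks₂₂ +
    trace (fromBlocks 1 0 0 0 * A.val * vecMulVec v v) + 1

omit [Finite F] in
theorem trace_mul_vecMulVec {m : Type*} [Fintype m] (M : Matrix m m F) (v : m → F) :
    trace (M * vecMulVec v v) = v ⬝ᵥ M *ᵥ v := by
  rw [mul_vecMulVec, trace_vecMulVec, dotProduct_comm]

omit [Finite F] in
theorem shift_blockLower {r k : ℕ} (S : GL (Fin r) F) (C : Matrix (Fin k) (Fin r) F)
    (T : GL (Fin k) F) (v : Fin r → F) (w : Fin k → F) :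
    shift (blockLower (S, C, T)) (Sum.elim v w) =
      trace T.val + trace (T⁻¹).val + v ⬝ᵥ S.val *ᵥ v + 1 := by
  have h1 : (blockLower (S, C, T)).val.toBlocks₂₂ = T.val := by simp [blockLower]
  have h2 : ((blockLower (S, C, T))⁻¹).val.toBlocks₂₂ = (T⁻¹).val := rfl
  have h3 : (fromBlocks 1 0 0 0 * (blockLower (S, C, T)).val :
      Matrix (Fin r ⊕ Fin k) (Fin r ⊕ Fin k) F) = fromBlocks S.val 0 0 0 := by
    simp [blockLower, fromBlocks_multiply]
  rw [shift, h1, h2, h3, trace_mul_vecMulVec, fromBlocks_mulVec, sumElim_dotProduct_sumElim]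
  simp

/-- Only block lower triangular `A` with symmetric corner `S` enter. The block `C` and the tail of
`v` are free, and `quadCount_of_even` collapses the sum over `S` and the head of `v` to the
condition `Tr T + Tr T⁻¹ = β - 1`. -/
theorem sum_isSymm_shift [DecidableEq F] (m k : ℕ) (β : F)
    [Fintype (GL (Fin (2 * m) ⊕ Fin k) F)] [Fintype (Fin (2 * m) ⊕ Fin k → F)] 
    [DecidablePred fun A : GL (Fin (2 * m) ⊕ Fin k) F =>
      (fromBlocks 1 0 0 0 * A.val : Matrix (Fin (2 * m) ⊕ Fin k) (Fin (2 * m) ⊕ Fin k) F).IsSymm] :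
    ∑ A : GL (Fin (2 * m) ⊕ Fin k) F with (fromBlocks 1 0 0 0 * A.val :
      Matrix (Fin (2 * m) ⊕ Fin k) (Fin (2 * m) ⊕ Fin k) F).IsSymm, ∑ v : Fin (2 * m) ⊕ Fin k → F,
      ((Nat.card F : ℚ) * (if shift A v = β then 1 else 0) - 1) =
    (Nat.card F : ℚ) ^ (k * (2 * m) + k) * Nat.card (SymInv F (Fin (2 * m))) *
      ((Nat.card F : ℚ) * glTraceCount k (β - 1) - Nat.card (GL (Fin k) F)) := by
  classical
  have := Fintype.ofFinite F
  let ψ : Matrix (Fin k) (Fin (2 * m)) F × GL (Fin k) F × SymInv F (Fin (2 * m)) →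
      GL (Fin (2 * m) ⊕ Fin k) F := fun x =>
    blockLower (GeneralLinearGroup.mkOfDetNeZero x.2.2.1 x.2.2.2.2, x.1, x.2.1)
  have hψ : Function.Injective ψ := by
    rintro ⟨C, T, S⟩ ⟨C', T', S'⟩ h
    have h' := blockLower_injective h
    simp only [Prod.mk.injEq] at h'
    have hS : S = S' := Subtype.ext (congrArg Units.val h'.1)
    rw [h'.2.1, h'.2.2, hS]
  have himg : ({A : GL (Fin (2 * m) ⊕ Fin k) F | (fromBlocks 1 0 0 0 * A.val :
      Matrix (Fin (2 * m) ⊕ Fin k) (Fin (2 * m) ⊕ Fin k) F).IsSymm} : Finset _) =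
      univ.image ψ := by
    ext A
    simp only [mem_filter, mem_univ, true_and, mem_image, isSymm_head_mul_iff]
    constructor
    · rintro ⟨h1, h2⟩
      obtain ⟨⟨S, C, T⟩, rfl⟩ := exists_blockLower_eq h1
      have hS : S.val.IsSymm := by simpa [blockLower] using h2
      exact ⟨(C, T, ⟨S.val, hS, det_GL_ne_zero S⟩), congrArg blockLower
        (Prod.ext (Units.ext rfl) rfl)⟩
    · rintro ⟨x, rfl⟩
      refine ⟨by simp [ψ, blockLower], ?_⟩
      simpa [ψ, blockLower] using x.2.2.2.1
  rw [himg, sum_image fun x _ y _ h => hψ h]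
  have hv : ∀ x, ∑ v : Fin (2 * m) ⊕ Fin k → F,
      ((Nat.card F : ℚ) * (if shift (ψ x) v = β then 1 else 0) - 1) =
      (Nat.card F : ℚ) ^ k * ∑ v : Fin (2 * m) → F, ((Nat.card F : ℚ) *
        (if v ⬝ᵥ x.2.2.1 *ᵥ v = β - 1 - (trace x.2.1.val + trace (x.2.1⁻¹).val) then 1 else 0)
          - 1) := by
    intro x
    -- The tail of `v` does not occur in the shift, hence the factor `q^k`.
    rw [← (Equiv.sumArrowEquivProdArrow (Fin (2 * m)) (Fin k) F).symm.sum_comp, Fintype.sum_prod_type,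
      mul_sum]
    refine sum_congr rfl fun v _ => ?_
    rw [sum_congr rfl (g := fun _ => ((Nat.card F : ℚ) * (if v ⬝ᵥ x.2.2.1 *ᵥ v = β - 1 -
      (trace x.2.1.val + trace (x.2.1⁻¹).val) then 1 else 0) - 1))]
    · rw [sum_const, card_univ, nsmul_eq_mul, Fintype.card_fun, Fintype.card_fin,
        ← Nat.card_eq_fintype_card, Nat.cast_pow]
    · intro w _
      have : shift (ψ x) ((Equiv.sumArrowEquivProdArrow (Fin (2 * m)) (Fin k) F).symm (v, w)) =
          trace x.2.1.val + trace (x.2.1⁻¹).val + v ⬝ᵥ x.2.2.1 *ᵥ v + 1 :=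
        shift_blockLower _ _ _ _ _
      rw [this]
      congr 3
      exact propext ⟨fun h => by rw [← h]; ring, fun h => by rw [h]; ring⟩
  simp only [hv]
  have hC : ∀ f : GL (Fin k) F × SymInv F (Fin (2 * m)) → ℚ,
      ∑ x : Matrix (Fin k) (Fin (2 * m)) F × GL (Fin k) F × SymInv F (Fin (2 * m)), f x.2 =
        Nat.card (Matrix (Fin k) (Fin (2 * m)) F) * ∑ T, ∑ S, f (T, S) := by
    intro f
    rw [Fintype.sum_prod_type]
    simp only
    rw [sum_const, card_univ, nsmul_eq_mul, Fintype.sum_prod_type, Nat.card_eq_fintype_card]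
  rw [← mul_sum]
  refine (congrArg (_ * ·) (hC fun y => ∑ v : Fin (2 * m) → F, ((Nat.card F : ℚ) *
        (if v ⬝ᵥ y.2.1 *ᵥ v = β - 1 - (trace y.1.val + trace (y.1⁻¹).val) then 1 else 0)
          - 1))).trans ?_
  have hT : ∀ T : GL (Fin k) F, ∑ S : SymInv F (Fin (2 * m)), ∑ v : Fin (2 * m) → F,
      ((Nat.card F : ℚ) * (if v ⬝ᵥ S.1 *ᵥ v = β - 1 - (trace T.val + trace (T⁻¹).val)
        then 1 else 0) - 1) = Nat.card (SymInv F (Fin (2 * m))) * ((Nat.card F : ℚ) *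
        (if trace T.val + trace (T⁻¹).val = β - 1 then 1 else 0) - 1) := by
    intro T
    rw [← Fintype.sum_prod_type' (f := fun (S : SymInv F (Fin (2 * m))) (v : Fin (2 * m) → F) =>
      ((Nat.card F : ℚ) * (if v ⬝ᵥ S.1 *ᵥ v = β - 1 - (trace T.val + trace (T⁻¹).val)
        then 1 else 0) - 1)), sum_ite_eq_card]
    have h1 := quadCount_of_even (F := F) m (β - 1 - (trace T.val + trace (T⁻¹).val))
    rw [quadCount] at h1
    rw [h1, Nat.card_prod, Nat.card_fun, Nat.card_fin]
    simp only [sub_eq_zero, eq_comm (a := β - 1)]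
    push_cast
    split_ifs <;> ring
  simp only [hT]
  rw [← mul_sum, sum_ite_eq_card, glTraceCount, natCard_matrix,
    Fintype.card_fin, Fintype.card_fin]
  push_cast
  ring

/-- Summing over `K` first for fixed `A` and `v` gives the uniform main term, plus the correction
from symmetric `PA`. -/
theorem ncard_trace_mul_sigma_eq (h3 : (3 : F) = 0) (m k : ℕ) (β : F) :
    (Nat.card F : ℚ) * {x | x ∈ Q F (2 * m + k) ∧
        (x * sigma F (2 * m + k) (2 * m)).trace = β}.ncard =
      Nat.card (GL (Fin (2 * m + k)) F) * ((Nat.card F : ℚ) ^ (2 * m + k).choose 2 *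
        (Nat.card F : ℚ) ^ (2 * m + k)) + (Nat.card F : ℚ) ^ (2 * m + k).choose 2 *
      ((Nat.card F : ℚ) ^ (k * (2 * m) + k) * Nat.card (SymInv F (Fin (2 * m))) *
      ((Nat.card F : ℚ) * glTraceCount k (β - 1) - Nat.card (GL (Fin k) F))) := by
  classical
  have := Fintype.ofFinite F
  rw [ncard_Q_filter h3, ← Nat.card_coe_set_eq]
  let e : {t : GL (Fin (2 * m) ⊕ Fin k) F × Skew F (Fin (2 * m) ⊕ Fin k) × (Fin (2 * m) ⊕ Fin k → F) |
      (qMat t * sigma F (2 * m + k) (2 * m)).trace = β} ≃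
      Σ p : GL (Fin (2 * m) ⊕ Fin k) F × (Fin (2 * m) ⊕ Fin k → F),
        {K : Skew F (Fin (2 * m) ⊕ Fin k) //
          trace (fromBlocks 1 0 0 0 * p.1.val * K.1) + shift p.1 p.2 = β} :=
    have key : ∀ A K v, (qMat (A, K, v) * sigma F (2 * m + k) (2 * m)).trace =
        trace (fromBlocks 1 0 0 0 * A.val * K.1) + shift A v := by
      intro A K v
      rw [trace_qMat_mul_sigma, shift, mul_add, trace_add]
      ring
    { toFun := fun t => ⟨(t.1.1, t.1.2.2), ⟨t.1.2.1, (key _ _ _).symm.trans t.2⟩⟩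
      invFun := fun x => ⟨(x.1.1, x.2.1, x.1.2), (key _ _ _).trans x.2.2⟩
      left_inv := fun _ => rfl
      right_inv := fun _ => rfl }
  rw [Nat.card_congr e, Nat.card_sigma, Nat.cast_sum, mul_sum]
  simp only [card_skew_trace_shift h3]
  rw [← mul_sum, sum_add_distrib, Fintype.sum_prod_type (f := fun p => ite _ _ _)]
  have hs := sum_isSymm_shift m k β
  rw [sum_filter] at hs
  have hs' : ∀ A : GL (Fin (2 * m) ⊕ Fin k) F, ∑ v : Fin (2 * m) ⊕ Fin k → F,
      (if (fromBlocks 1 0 0 0 * A.val :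
      Matrix (Fin (2 * m) ⊕ Fin k) (Fin (2 * m) ⊕ Fin k) F).IsSymm then
        ((Nat.card F : ℚ) * (if shift A v = β then 1 else 0) - 1) else 0) =
      if (fromBlocks 1 0 0 0 * A.val :
      Matrix (Fin (2 * m) ⊕ Fin k) (Fin (2 * m) ⊕ Fin k) F).IsSymm then
        ∑ v : Fin (2 * m) ⊕ Fin k → F,
        ((Nat.card F : ℚ) * (if shift A v = β then 1 else 0) - 1) else 0 := by
    intro A
    split_ifs <;> simp
  simp only [hs']
  rw [hs, sum_const, card_univ, nsmul_eq_mul, mul_one, ← Nat.card_eq_fintype_card, Nat.card_prod,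
    card_GL_congr finSumFinEquiv, card_skew_congr finSumFinEquiv, card_skew_fin h3, Nat.card_fun]
  simp only [Nat.card_sum, Nat.card_fin]
  push_cast
  ring

end Counts

/-! ### The equations `Tr T + Tr T⁻¹ = c` in `GL(1, F)` and `GL(2, F)` -/

section SmallGL

open Matrix

variable {F : Type*} [Field F]

theorem glTraceCount_one (c : F) : glTraceCount 1 c = delta 1 c := by
  let e : GL (Fin 1) F ≃ (Fin 1 → Fˣ) := Equiv.ofBijective
    (fun T _ => GeneralLinearGroup.det T) (by
      constructor
      · intro T T' h
        have h' := congrArg Units.val (congrFun h 0)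
        simp only [GeneralLinearGroup.val_det_apply, det_fin_one] at h'
        apply Units.ext
        ext i j
        rw [Subsingleton.elim i 0, Subsingleton.elim j 0, h']
      · intro α
        refine ⟨GeneralLinearGroup.mkOfDetNeZero (of fun _ _ => (α 0 : F)) (by simp), ?_⟩
        funext i
        apply Units.ext
        rw [Subsingleton.elim i 0]
        simp [GeneralLinearGroup.mkOfDetNeZero])
  refine Nat.card_congr (e.subtypeEquiv fun T => ?_)
  have h : ∀ T : GL (Fin 1) F, (GeneralLinearGroup.det T : F) = trace T.val := by
    intro T
    simp [GeneralLinearGroup.val_det_apply, trace]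
  have h1 : ((e T 0 : Fˣ) : F)⁻¹ = trace (T⁻¹).val := by
    rw [← h, map_inv, Units.val_inv_eq_inv_val]; rfl
  have h2 : ((e T 0 : Fˣ) : F) = trace T.val := h T
  rw [Fin.sum_univ_one, h1, h2]

theorem trace_inv_fin_two (T : GL (Fin 2) F) :
    trace (T⁻¹).val = trace T.val * (T.val.det)⁻¹ := by
  rw [coe_units_inv, Matrix.inv_def, trace_smul, adjugate_fin_two, Ring.inverse_eq_inv',
    smul_eq_mul, mul_comm]
  congr 1
  simp [trace_fin_two, add_comm]

/-- A nonzero first factor determines the second; a zero first factor is possible only for `t = 0`,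
and then leaves the second free. This counts the off-diagonal pairs of a 2 × 2 matrix. -/
theorem card_mul_eq [Fintype F] [DecidableEq F] (t : F) :
    (Nat.card {p : F × F // p.1 * p.2 = t} : ℚ) =
      (Nat.card F : ℚ) - 1 + Nat.card F * (if t = 0 then 1 else 0) := by
  let e : {p : F × F // p.1 * p.2 = t} ≃ Σ b : F, {c : F // b * c = t} :=
    { toFun := fun p => ⟨p.1.1, p.1.2, p.2⟩
      invFun := fun x => ⟨(x.1, x.2.1), x.2.2⟩
      left_inv := fun _ => rfl
      right_inv := fun _ => rfl }
  rw [Nat.card_congr e, Nat.card_sigma, ← sum_erase_add _ _ (mem_univ 0),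
    sum_congr rfl (g := fun _ => 1)]
  · have h0 : Nat.card {c : F // 0 * c = t} = if t = 0 then Nat.card F else 0 := by
      split_ifs with h
      · exact Nat.card_congr (Equiv.subtypeUnivEquiv fun c => by simp [h])
      · have : IsEmpty {c : F // 0 * c = t} := ⟨fun c => h (by simpa using c.2.symm)⟩
        exact Nat.card_of_isEmpty
    rw [h0, sum_const, card_erase_of_mem (mem_univ _), card_univ, ← Nat.card_eq_fintype_card,
      smul_eq_mul, mul_one]
    push_cast [Nat.cast_sub (Nat.card_pos (α := F))]
    split_ifs <;> simp
  · intro b hb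
    have hb' := ne_of_mem_erase hb
    rw [Nat.card_eq_one_iff_unique]
    refine ⟨⟨fun x y => Subtype.ext (mul_left_cancel₀ hb' (x.2.trans y.2.symm))⟩,
      ⟨⟨b⁻¹ * t, mul_inv_cancel_left₀ hb' t⟩⟩⟩

/-- The triples `(a, d, Δ)` of the diagonal entries and the determinant of the `T ∈ GL(2, F)` with
`Tr T + Tr T⁻¹ = c`. -/
abbrev DiagDet (c : F) : Type _ :=
  {x : (F × F) × Fˣ // (x.1.1 + x.1.2) * (1 + (x.2 : F)⁻¹) = c}

/-- Invertible `2 × 2` matrices by diagonal entries, determinant and off-diagonal entries. -/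
noncomputable def glTwoEquiv : GL (Fin 2) F ≃ {y : ((F × F) × Fˣ) × (F × F) //
    y.2.1 * y.2.2 = y.1.1.1 * y.1.1.2 - y.1.2} where
  toFun T := ⟨(((T.val 0 0, T.val 1 1), GeneralLinearGroup.det T), (T.val 0 1, T.val 1 0)), by
    simp only [GeneralLinearGroup.val_det_apply, det_fin_two]; ring⟩
  invFun y := GeneralLinearGroup.mkOfDetNeZero !![y.1.1.1.1, y.1.2.1; y.1.2.2, y.1.1.1.2] (by
    rw [det_fin_two_of, y.2, sub_sub_cancel]; exact y.1.1.2.ne_zero)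
  left_inv T := Units.ext (eta_fin_two T.val).symm
  right_inv y := by
    refine Subtype.ext (Prod.ext (Prod.ext rfl (Units.ext ?_)) rfl)
    change det !![y.1.1.1.1, y.1.2.1; y.1.2.2, y.1.1.1.2] = _
    rw [det_fin_two_of, y.2, sub_sub_cancel]

theorem glTraceCount_two_eq_card (c : F) : glTraceCount 2 c =
    Nat.card (Σ x : DiagDet c, {p : F × F // p.1 * p.2 = x.1.1.1 * x.1.1.2 - x.1.2}) := by
  have h : ∀ T : GL (Fin 2) F, trace T.val + trace (T⁻¹).val = c ↔
      ((glTwoEquiv T).1.1.1.1 + (glTwoEquiv T).1.1.1.2) *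
        (1 + ((glTwoEquiv T).1.1.2 : F)⁻¹) = c := by
    intro T
    rw [trace_inv_fin_two, trace_fin_two]
    change _ ↔ (T.val 0 0 + T.val 1 1) * (1 + T.val.det⁻¹) = c
    rw [mul_add, mul_one]
  refine (Nat.card_congr (glTwoEquiv.subtypeEquiv
    (q := fun y => (y.1.1.1.1 + y.1.1.1.2) * (1 + (y.1.1.2 : F)⁻¹) = c) h)).trans (Nat.card_congr ?_)
  exact
    { toFun := fun y => ⟨⟨y.1.1.1, y.2⟩, ⟨y.1.1.2, y.1.2⟩⟩
      invFun := fun x => ⟨⟨(x.1.1, x.2.1), x.2.2⟩, x.1.2⟩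
      left_inv := fun _ => rfl
      right_inv := fun _ => rfl }

/-- The first diagonal entry is free, and the trace solves a linear equation that degenerates only
at determinant -1. -/
theorem card_diagDet [Fintype F] [DecidableEq F] (c : F) :
    (Nat.card (DiagDet c) : ℚ) = Nat.card F * ((Nat.card F : ℚ) - 2 +
      Nat.card F * (if c = 0 then 1 else 0)) := by
  let e : DiagDet c ≃ F × Σ u : Fˣ, {t : F // t * (1 + (u : F)⁻¹) = c} :=
    { toFun := fun x => (x.1.1.1, ⟨x.1.2, x.1.1.1 + x.1.1.2, x.2⟩)
      invFun := fun y => ⟨((y.1, y.2.2.1 - y.1), y.2.1), by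
        simp only [add_sub_cancel]; exact y.2.2.2⟩
      left_inv := by
        rintro ⟨⟨⟨a, d⟩, u⟩, h⟩
        simp
      right_inv := by
        rintro ⟨a, u, t, h⟩
        simp }
  have h0 : Nat.card {t : F // t * (1 + ((-1 : Fˣ) : F)⁻¹) = c} =
      if c = 0 then Nat.card F else 0 := by
    have h1 : (1 + ((-1 : Fˣ) : F)⁻¹) = 0 := by simp [inv_neg]
    rw [h1]
    split_ifs with h
    · exact Nat.card_congr (Equiv.subtypeUnivEquiv fun t => by simp [h])
    · have : IsEmpty {t : F // t * 0 = c} := ⟨fun t => h (by simpa using t.2.symm)⟩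
      exact Nat.card_of_isEmpty
  have hu : Fintype.card Fˣ = Nat.card F - 1 := by
    rw [Fintype.card_units, Nat.card_eq_fintype_card]
  have h2 : 2 ≤ Nat.card F := Finite.one_lt_card
  rw [Nat.card_congr e, Nat.card_prod, Nat.card_sigma, ← sum_erase_add _ _ (mem_univ (-1)), h0,
    sum_congr rfl (g := fun _ => 1), sum_const, card_erase_of_mem (mem_univ _), card_univ, hu,
    smul_eq_mul, mul_one, Nat.sub_sub]
  · push_cast [Nat.cast_sub h2]
    split_ifs <;> simp
  · intro u hu
    have hu' : 1 + (u : F)⁻¹ ≠ 0 := by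
      intro h
      refine ne_of_mem_erase hu (Units.ext ?_)
      have : (u : F)⁻¹ = -1 := (neg_eq_of_add_eq_zero_right h).symm
      rw [← inv_inv (u : F), this]
      simp [inv_neg]
    rw [Nat.card_eq_one_iff_unique]
    exact ⟨⟨fun x y => Subtype.ext (mul_right_cancel₀ hu' (x.2.trans y.2.symm))⟩,
      ⟨⟨c * (1 + (u : F)⁻¹)⁻¹, inv_mul_cancel_right₀ hu' c⟩⟩⟩

/-- When `ad` is the determinant, both entries are nonzero and `(a + d)(1 + (ad)⁻¹) = a + a⁻¹ + d +
d⁻¹`. -/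
theorem card_diagDet_mul_eq (c : F) :
    Nat.card {x : DiagDet c // x.1.1.1 * x.1.1.2 - x.1.2 = 0} = delta 2 c := by
  symm
  refine Nat.card_congr (Equiv.ofBijective (fun α => ⟨⟨((α.1 0, α.1 1), α.1 0 * α.1 1), ?_⟩, ?_⟩)
    ⟨?_, ?_⟩)
  · have h := α.2
    rw [Fin.sum_univ_two] at h
    have h0 := (α.1 0).ne_zero
    have h1 := (α.1 1).ne_zero
    refine Eq.trans ?_ h
    push_cast
    field_simp
    ring
  · simp
  · intro α α' h
    have h' := congrArg (fun x => x.1.1.1) h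
    simp only [Prod.mk.injEq] at h'
    apply Subtype.ext
    funext i
    fin_cases i
    · exact Units.ext h'.1
    · exact Units.ext h'.2
  · rintro ⟨⟨⟨⟨a, d⟩, u⟩, hx⟩, h⟩
    simp only at hx h
    have h' : a * d = u := sub_eq_zero.1 h
    have hu := u.ne_zero
    rw [← h'] at hu
    have ha := left_ne_zero_of_mul hu
    have hd := right_ne_zero_of_mul hu
    refine ⟨⟨![Units.mk0 a ha, Units.mk0 d hd], ?_⟩, ?_⟩
    · rw [Fin.sum_univ_two, ← hx, ← h']
      simp only [cons_val_zero, cons_val_one, Units.val_mk0]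
      field_simp
      ring
    · apply Subtype.ext
      apply Subtype.ext
      refine Prod.ext rfl (Units.ext ?_)
      simpa using h'

/-- Each admissible diagonal and determinant has `q - 1` completions, with `q` more when the
off-diagonal product has to be 0; these exceptional cases are counted by `δ(2, q; c)`. -/
theorem glTraceCount_two [Fintype F] [DecidableEq F] (c : F) : (glTraceCount 2 c : ℚ) =
    Nat.card F * delta 2 c + Nat.card F * (Nat.card F - 1) * (Nat.card F - 2 +
      Nat.card F * (if c = 0 then 1 else 0)) := by
  classical
  rw [glTraceCount_two_eq_card, Nat.card_sigma]
  push_cast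
  simp only [card_mul_eq]
  rw [sum_add_distrib, ← mul_sum, sum_const, card_univ, nsmul_eq_mul, ← Nat.card_eq_fintype_card,
    card_diagDet, sum_boole, ← card_diagDet_mul_eq, Nat.card_eq_fintype_card (α := {x : DiagDet c // _}),
    Fintype.card_subtype]
  ring

end SmallGL

/-! ### Closed formulas -/

section Formulas

open Matrix

variable {F : Type*} [Field F] [Finite F]

theorem card_GL_succ (n : ℕ) : (Nat.card (GL (Fin (n + 1)) F) : ℚ) =
    Nat.card (GL (Fin n) F) * (Nat.card F : ℚ) ^ n * ((Nat.card F : ℚ) ^ (n + 1) - 1) := by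
  have := Fintype.ofFinite F
  have key : ∀ n : ℕ, (Nat.card (GL (Fin n) F) : ℚ) =
      ∏ i : Fin n, ((Nat.card F : ℚ) ^ n - (Nat.card F : ℚ) ^ (i : ℕ)) := by
    intro n
    rw [card_GL_field, Nat.cast_prod]
    refine prod_congr rfl fun i _ => ?_
    rw [Nat.cast_sub (Nat.pow_le_pow_right Fintype.card_pos i.2.le), Nat.card_eq_fintype_card]
    push_cast
    rfl
  rw [key, key, Fin.prod_univ_succ]
  have : ∀ i : Fin n, ((Nat.card F : ℚ) ^ (n + 1) - (Nat.card F : ℚ) ^ ((i.succ : Fin (n + 1)) : ℕ))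
      = (Nat.card F : ℚ) * ((Nat.card F : ℚ) ^ n - (Nat.card F : ℚ) ^ (i : ℕ)) := by
    intro i
    rw [Fin.val_succ]; ring
  simp only [this]
  rw [prod_mul_distrib, prod_const, card_univ, Fintype.card_fin]
  simp only [Fin.val_zero, pow_zero]
  ring

theorem card_GL_zero : Nat.card (GL (Fin 0) F) = 1 := by
  have := Fintype.ofFinite F
  rw [card_GL_field]; simp

theorem choose_succ_two (n : ℕ) : (n + 1).choose 2 = n.choose 2 + n := by
  rw [Nat.choose_succ_succ' n 1, Nat.choose_one_right, add_comm]

theorem card_GL_two_mul (m : ℕ) : (Nat.card (GL (Fin (2 * m)) F) : ℚ) =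
    (Nat.card F : ℚ) ^ (2 * m).choose 2 * (∏ j ∈ Icc 1 m, ((Nat.card F : ℚ) ^ (2 * j - 1) - 1)) *
      ∏ j ∈ Icc 1 m, ((Nat.card F : ℚ) ^ (2 * j) - 1) := by
  induction m with
  | zero => simp
  | succ m ih =>
    have h : (2 * (m + 1)).choose 2 = (2 * m).choose 2 + 4 * m + 1 := by
      rw [show 2 * (m + 1) = 2 * m + 1 + 1 by ring, choose_succ_two, choose_succ_two]
      ring
    rw [mul_add, mul_one, card_GL_succ, card_GL_succ, ih, prod_Icc_succ_top (by omega),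
      prod_Icc_succ_top (by omega), show 2 * (m + 1) - 1 = 2 * m + 1 by omega,
      show 2 * m + 2 = 2 * (m + 1) by ring, h]
    ring

theorem choose_two_two_mul_add_one (m : ℕ) : (2 * m + 1).choose 2 = 2 * m ^ 2 + m := by
  induction m with
  | zero => rfl
  | succ m ih =>
    rw [show 2 * (m + 1) + 1 = 2 * m + 1 + 1 + 1 by ring, choose_succ_two, choose_succ_two, ih]
    ring

theorem choose_two_two_mul_add_two (m : ℕ) : (2 * m + 2).choose 2 = 2 * m ^ 2 + 3 * m + 1 := by
  rw [choose_succ_two, choose_two_two_mul_add_one]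
  ring

theorem Aminus_eq (m q : ℕ) : Aminus (2 * m + 1) q = (q : ℚ) ^ (5 * m ^ 2 + 5 * m + 1) *
    (((q : ℚ) ^ (2 * m + 1) - 1) / ((q : ℚ) - 1)) *
      ∏ j ∈ Icc 1 m, ((q : ℚ) ^ (2 * j - 1) - 1) := by
  have h : (5 * (2 * m + 1) ^ 2 - 1) / 4 = 5 * m ^ 2 + 5 * m + 1 := by
    have : 5 * (2 * m + 1) ^ 2 = 4 * (5 * m ^ 2 + 5 * m + 1) + 1 := by ring
    omega
  rw [Aminus, h, qBinom, show (2 * m + 1 - 1) / 2 = m by omega]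
  simp

theorem Bminus_eq (m q : ℕ) : Bminus (2 * m + 1) q = (q : ℚ) ^ (m ^ 2) *
    ((q : ℚ) ^ (2 * m + 1) - 1) * ∏ j ∈ Icc 1 m, ((q : ℚ) ^ (2 * j) - 1) := by
  have h : (2 * m + 1 - 1) ^ 2 / 4 = m ^ 2 := by
    rw [show 2 * m + 1 - 1 = 2 * m by omega, show (2 * m) ^ 2 = 4 * m ^ 2 by ring]
    omega
  rw [Bminus, h, show (2 * m + 1 - 1) / 2 = m by omega]

theorem Aplus_eq (m q : ℕ) : Aplus (2 * m + 2) q = (q : ℚ) ^ (5 * m ^ 2 + 9 * m + 4) *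
    (((q : ℚ) ^ (2 * m + 2) - 1) / ((q : ℚ) ^ 2 - 1) *
      (((q : ℚ) ^ (2 * m + 1) - 1) / ((q : ℚ) - 1))) *
      ∏ j ∈ Icc 1 m, ((q : ℚ) ^ (2 * j - 1) - 1) := by
  have h : (5 * (2 * m + 2) ^ 2 - 2 * (2 * m + 2)) / 4 = 5 * m ^ 2 + 9 * m + 4 := by
    have : 5 * (2 * m + 2) ^ 2 = 4 * (5 * m ^ 2 + 9 * m + 4) + 2 * (2 * m + 2) := by ring
    omega
  rw [Aplus, h, qBinom, show (2 * m + 2 - 2) / 2 = m by omega]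
  rw [prod_range_succ, prod_range_succ, prod_range_zero, one_mul,
    show 2 * m + 2 - 1 = 2 * m + 1 by omega]
  simp

theorem Bplus_eq (m q : ℕ) : Bplus (2 * m + 2) q = (q : ℚ) ^ (m ^ 2) *
    ((q : ℚ) ^ (2 * m + 2) - 1) * ((q : ℚ) ^ (2 * m + 1) - 1) *
      ∏ j ∈ Icc 1 m, ((q : ℚ) ^ (2 * j) - 1) := by
  have h : (2 * m + 2 - 2) ^ 2 / 4 = m ^ 2 := by
    rw [show 2 * m + 2 - 2 = 2 * m by omega, show (2 * m) ^ 2 = 4 * m ^ 2 by ring]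
    omega
  rw [Bplus, h, show (2 * m + 2 - 2) / 2 = m by omega, show 2 * m + 2 - 1 = 2 * m + 1 by omega]

theorem one_lt_natCard_cast : (1 : ℚ) < Nat.card F := by exact_mod_cast Finite.one_lt_card

theorem card_GL_one : (Nat.card (GL (Fin 1) F) : ℚ) = (Nat.card F : ℚ) - 1 := by
  rw [card_GL_succ, card_GL_zero]; simp

theorem card_GL_two : (Nat.card (GL (Fin 2) F) : ℚ) =
    ((Nat.card F : ℚ) - 1) * Nat.card F * ((Nat.card F : ℚ) ^ 2 - 1) := by
  rw [card_GL_succ, card_GL_one]; simp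

/-- The stabilizer of `σ_r` in `Q`, `r = 2m`. -/
noncomputable def stabCard (F : Type*) [Field F] (m k : ℕ) : ℚ :=
  Nat.card (GL (Fin (2 * m)) F) * ((Nat.card F : ℚ) ^ (k * (2 * m)) * Nat.card (GL (Fin k) F)) *
    ((Nat.card F : ℚ) ^ (2 * m * k) * (Nat.card F : ℚ) ^ k.choose 2 * (Nat.card F : ℚ) ^ k)

/-- The order of `Q(2n+1, q)`. -/
noncomputable def qCard (F : Type*) [Field F] (n : ℕ) : ℚ :=
  Nat.card (GL (Fin n) F) * ((Nat.card F : ℚ) ^ n.choose 2 * (Nat.card F : ℚ) ^ n)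

/-- The weight with which `GL(k, F)` contributes to the trace distribution of `Q σ_{2m}`. -/
noncomputable def levelCard (F : Type*) [Field F] (m k : ℕ) : ℚ :=
  (Nat.card F : ℚ) ^ (2 * m + k).choose 2 *
    ((Nat.card F : ℚ) ^ (k * (2 * m) + k) * Nat.card (SymInv F (Fin (2 * m))))

theorem stabCard_ne_zero (m k : ℕ) : stabCard F m k ≠ 0 := by
  have h1 : ∀ n : ℕ, (Nat.card (GL (Fin n) F) : ℚ) ≠ 0 := fun n =>
    Nat.cast_ne_zero.2 Nat.card_pos.ne'
  have h2 : (Nat.card F : ℚ) ≠ 0 := Nat.cast_ne_zero.2 Nat.card_pos.ne'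
  simp [stabCard, h1, h2]

/-- With its companion for `B⁻`, this identifies `A⁻` as `|Q|` times the level weight over the
stabilizer order, and `B⁻` as `|Q|` over the level weight, so `A⁻B⁻` is the size of the double
coset. -/
theorem Aminus_mul_stabCard (m : ℕ) : Aminus (2 * m + 1) (Nat.card F) * stabCard F m 1 =
    qCard F (2 * m + 1) * levelCard F m 1 := by
  have h1 : (Nat.card F : ℚ) - 1 ≠ 0 := (sub_pos.2 one_lt_natCard_cast).ne'
  rw [Aminus_eq, stabCard, qCard, levelCard, card_GL_one, card_GL_succ, card_symInv_two_mul,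
    choose_two_two_mul_add_one]
  simp only [Nat.choose_succ_self, pow_zero]
  field_simp
  ring

theorem Bminus_mul_levelCard (m : ℕ) : Bminus (2 * m + 1) (Nat.card F) * levelCard F m 1 =
    qCard F (2 * m + 1) := by
  have h : (2 * m + 1).choose 2 = (2 * m).choose 2 + 2 * m := choose_succ_two _
  -- The power of `q` in the order of `GL(2m)` is kept as a binomial coefficient; only together with
  -- `q^(2m)` does it become a polynomial exponent without subtraction.
  have h' : (Nat.card F : ℚ) ^ (2 * m).choose 2 * (Nat.card F : ℚ) ^ (2 * m) =
      (Nat.card F : ℚ) ^ (2 * m ^ 2 + m) := by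
    rw [← pow_add, ← h, choose_two_two_mul_add_one]
  rw [Bminus_eq, qCard, levelCard, card_GL_succ, card_symInv_two_mul, card_GL_two_mul,
    choose_two_two_mul_add_one]
  generalize ∏ j ∈ Icc 1 m, ((Nat.card F : ℚ) ^ (2 * j) - 1) = E
  generalize ∏ j ∈ Icc 1 m, ((Nat.card F : ℚ) ^ (2 * j - 1) - 1) = O
  calc _ = (Nat.card F : ℚ) ^ (2 * m ^ 2 + m) * O * E * ((Nat.card F : ℚ) ^ (2 * m + 1) - 1) *
      ((Nat.card F : ℚ) ^ (2 * m ^ 2 + m) * (Nat.card F : ℚ) ^ (2 * m + 1)) := by ring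
    _ = _ := by rw [← h']; ring

/-- The additional factor `q` is the one common to `q·glTraceCount 2` and `|GL(2)|`; it is moved
from the correction term into the constant. -/
theorem Aplus_mul_stabCard (m : ℕ) : Aplus (2 * m + 2) (Nat.card F) * stabCard F m 2 =
    qCard F (2 * m + 2) * (levelCard F m 2 * Nat.card F) := by
  have h1 : (Nat.card F : ℚ) - 1 ≠ 0 := (sub_pos.2 one_lt_natCard_cast).ne'
  have h2 : (Nat.card F : ℚ) ^ 2 - 1 ≠ 0 :=
    (sub_pos.2 (one_lt_pow₀ one_lt_natCard_cast two_ne_zero)).ne'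
  rw [Aplus_eq, stabCard, qCard, levelCard, card_GL_two, card_GL_succ, card_GL_succ,
    card_symInv_two_mul, choose_two_two_mul_add_two]
  simp only [Nat.choose_self, pow_one]
  field_simp
  ring

theorem Bplus_mul_levelCard (m : ℕ) :
    Bplus (2 * m + 2) (Nat.card F) * (levelCard F m 2 * Nat.card F) = qCard F (2 * m + 2) := by
  have h : (2 * m + 1).choose 2 = (2 * m).choose 2 + 2 * m := choose_succ_two _
  have h' : (Nat.card F : ℚ) ^ (2 * m).choose 2 * (Nat.card F : ℚ) ^ (2 * m) =
      (Nat.card F : ℚ) ^ (2 * m ^ 2 + m) := by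
    rw [← pow_add, ← h, choose_two_two_mul_add_one]
  rw [Bplus_eq, qCard, levelCard, card_GL_succ, card_GL_succ, card_symInv_two_mul, card_GL_two_mul,
    choose_two_two_mul_add_two]
  generalize ∏ j ∈ Icc 1 m, ((Nat.card F : ℚ) ^ (2 * j) - 1) = E
  generalize ∏ j ∈ Icc 1 m, ((Nat.card F : ℚ) ^ (2 * j - 1) - 1) = O
  calc _ = (Nat.card F : ℚ) ^ (2 * m ^ 2 + m) * O * E * ((Nat.card F : ℚ) ^ (2 * m + 1) - 1) *
      (Nat.card F : ℚ) ^ (2 * m + 1) * ((Nat.card F : ℚ) ^ (2 * m + 2) - 1) *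
      ((Nat.card F : ℚ) ^ (2 * m ^ 2 + 3 * m + 1) * (Nat.card F : ℚ) ^ (2 * m + 2)) := by ring
    _ = _ := by rw [← h']; ring

/-! ### Trace distribution of the double cosets -/

theorem ncard_Q_cast (h3 : (3 : F) = 0) (r k : ℕ) : ((Q F (r + k)).ncard : ℚ) =
    qCard F (r + k) := by
  rw [ncard_Q h3, qCard]; push_cast; ring

theorem stabCard_mul_ncard (h3 : (3 : F) = 0) (m k : ℕ) {X : Type*} (f : Mat F (2 * m + k) → X)
    (hf : ∀ x y, f (x * y) = f (y * x)) (β : X) :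
    stabCard F m k * {w | w ∈ doubleCoset F (2 * m + k) (2 * m) ∧ f w = β}.ncard =
      qCard F (2 * m + k) * {x | x ∈ Q F (2 * m + k) ∧
        f (x * sigma F (2 * m + k) (2 * m)) = β}.ncard := by
  have h := ncard_doubleCoset_mul (Q F (2 * m + k)) (fun x hx y hy => Q_mul_mem hx hy)
    (fun x hx => Q_exists_inv hx) (sigma_mul_self (2 * m)) f hf β
  rw [ncard_stabilizer h3] at h
  have h' := congrArg (Nat.cast : ℕ → ℚ) h
  push_cast at h'
  rw [ncard_Q_cast h3] at h'
  exact h'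

/-- The total count is the case of a constant class function. -/
theorem stabCard_mul_ncard_doubleCoset (h3 : (3 : F) = 0) (m k : ℕ) :
    stabCard F m k * (doubleCoset F (2 * m + k) (2 * m)).ncard =
      qCard F (2 * m + k) * qCard F (2 * m + k) := by
  have h := stabCard_mul_ncard h3 m k (fun _ : Mat F (2 * m + k) => ()) (fun _ _ => rfl) ()
  simp only [and_true] at h
  have e : ∀ S : Set (Mat F (2 * m + k)), {w | w ∈ S} = S := fun S => by ext; simp
  rw [e, e, ncard_Q_cast h3] at h
  exact h

theorem stabCard_mul_ncard_trace_eq (h3 : (3 : F) = 0) (m k : ℕ) (β : F) :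
    (Nat.card F : ℚ) * (stabCard F m k *
      {w ∈ doubleCoset F (2 * m + k) (2 * m) | w.trace = β}.ncard) =
    qCard F (2 * m + k) * (qCard F (2 * m + k) + levelCard F m k *
      ((Nat.card F : ℚ) * glTraceCount k (β - 1) - Nat.card (GL (Fin k) F))) := by
  have h := stabCard_mul_ncard h3 m k (trace : Mat F (2 * m + k) → F) trace_mul_comm β
  have h' := ncard_trace_mul_sigma_eq h3 m k β
  rw [h, mul_left_comm, h', qCard, levelCard]
  ring

theorem ncard_doubleCoset_minus (h3 : (3 : F) = 0) (m : ℕ) :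
    ((doubleCoset F (2 * m + 1) (2 * m)).ncard : ℚ) =
      Aminus (2 * m + 1) (Nat.card F) * Bminus (2 * m + 1) (Nat.card F) := by
  apply mul_left_cancel₀ (stabCard_ne_zero (F := F) m 1)
  rw [stabCard_mul_ncard_doubleCoset h3]
  have hA := Aminus_mul_stabCard (F := F) m
  have hB := Bminus_mul_levelCard (F := F) m
  linear_combination -qCard F (2 * m + 1) * hB - Bminus (2 * m + 1) (Nat.card F) * hA

theorem ncard_doubleCoset_minus_trace (h3 : (3 : F) = 0) (m : ℕ) (β : F) :
    ({w ∈ doubleCoset F (2 * m + 1) (2 * m) | w.trace = β}.ncard : ℚ) =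
      (Nat.card F : ℚ)⁻¹ * Aminus (2 * m + 1) (Nat.card F) *
        (Bminus (2 * m + 1) (Nat.card F) + Nat.card F * delta 1 (β - 1) - Nat.card F + 1) := by
  have hq : (Nat.card F : ℚ) ≠ 0 := Nat.cast_ne_zero.2 Nat.card_pos.ne'
  apply mul_left_cancel₀ (stabCard_ne_zero (F := F) m 1)
  apply mul_left_cancel₀ hq
  rw [stabCard_mul_ncard_trace_eq h3, glTraceCount_one, card_GL_one]
  have hA := Aminus_mul_stabCard (F := F) m
  have hB := Bminus_mul_levelCard (F := F) m
  field_simp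
  linear_combination -qCard F (2 * m + 1) * hB -
    (Bminus (2 * m + 1) (Nat.card F) + Nat.card F * delta 1 (β - 1) - Nat.card F + 1) * hA

theorem ncard_doubleCoset_plus (h3 : (3 : F) = 0) (m : ℕ) :
    ((doubleCoset F (2 * m + 2) (2 * m)).ncard : ℚ) =
      Aplus (2 * m + 2) (Nat.card F) * Bplus (2 * m + 2) (Nat.card F) := by
  apply mul_left_cancel₀ (stabCard_ne_zero (F := F) m 2)
  rw [stabCard_mul_ncard_doubleCoset h3]
  have hA := Aplus_mul_stabCard (F := F) m
  have hB := Bplus_mul_levelCard (F := F) m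
  linear_combination -qCard F (2 * m + 2) * hB - Bplus (2 * m + 2) (Nat.card F) * hA

theorem ncard_doubleCoset_plus_trace [DecidableEq F] (h3 : (3 : F) = 0) (m : ℕ) (β : F) :
    ({w ∈ doubleCoset F (2 * m + 2) (2 * m) | w.trace = β}.ncard : ℚ) =
      (Nat.card F : ℚ)⁻¹ * Aplus (2 * m + 2) (Nat.card F) *
        (Bplus (2 * m + 2) (Nat.card F) + Nat.card F * delta 2 (β - 1) +
          (if β = 1 then ((Nat.card F : ℚ) - 1) ^ 3
            else -2 * (Nat.card F : ℚ) ^ 2 + 3 * Nat.card F - 1)) := by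
  have := Fintype.ofFinite F
  have hq : (Nat.card F : ℚ) ≠ 0 := Nat.cast_ne_zero.2 Nat.card_pos.ne'
  apply mul_left_cancel₀ (stabCard_ne_zero (F := F) m 2)
  apply mul_left_cancel₀ hq
  rw [stabCard_mul_ncard_trace_eq h3, glTraceCount_two, card_GL_two]
  have hA := Aplus_mul_stabCard (F := F) m
  have hB := Bplus_mul_levelCard (F := F) m
  simp only [sub_eq_zero]
  split_ifs with h
  · field_simp
    linear_combination -qCard F (2 * m + 2) * hB -
      (Bplus (2 * m + 2) (Nat.card F) + Nat.card F * delta 2 (β - 1) +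
        ((Nat.card F : ℚ) - 1) ^ 3) * hA
  · field_simp
    linear_combination -qCard F (2 * m + 2) * hB -
      (Bplus (2 * m + 2) (Nat.card F) + Nat.card F * delta 2 (β - 1) +
        (-2 * (Nat.card F : ℚ) ^ 2 + 3 * Nat.card F - 1)) * hA

/-! ### The coset of `ρ` -/

omit [Finite F] in
theorem rho_eq_neg_levi (n : ℕ) : rho F n = -levi (-1 : GL (Fin n) F) := by
  have h : ((-1 : GL (Fin n) F)⁻¹) = -1 := by rw [inv_neg, inv_one]
  rw [rho, levi, h, fromBlocks_neg, fromBlocks_neg]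
  simp

omit [Finite F] in
-- The Levi factor of `ρ = -levi (-1)` is absorbed into `Q`, leaving only the sign.
theorem mem_rhoDoubleCoset_iff {n r : ℕ} (w : Mat F n) :
    w ∈ rhoDoubleCoset F n r ↔ -w ∈ doubleCoset F n r := by
  have hl : levi (-1 : GL (Fin n) F) * levi (-1 : GL (Fin n) F) = 1 := by
    rw [levi_mul_levi, neg_mul_neg, one_mul]; simp [levi]
  constructor
  · rintro ⟨x, hx, y, hy, rfl⟩
    refine ⟨levi (-1 : GL (Fin n) F) * x, Q_mul_mem (levi_mem_Q _) hx, y, hy, ?_⟩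
    rw [rho_eq_neg_levi]
    simp only [neg_mul, neg_neg]
  · rintro ⟨x, hx, y, hy, h⟩
    refine ⟨levi (-1 : GL (Fin n) F) * x, Q_mul_mem (levi_mem_Q _) hx, y, hy, ?_⟩
    rw [← neg_neg w, h, rho_eq_neg_levi, ← mul_assoc, neg_mul, hl]
    simp

omit [Finite F] in
theorem ncard_rhoDoubleCoset (n r : ℕ) :
    (rhoDoubleCoset F n r).ncard = (doubleCoset F n r).ncard := by
  rw [← Set.ncard_image_of_injective (doubleCoset F n r) neg_injective]
  congr 1
  ext w
  rw [mem_rhoDoubleCoset_iff]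
  exact ⟨fun h => ⟨_, h, neg_neg w⟩, by rintro ⟨x, h, rfl⟩; rwa [neg_neg]⟩

omit [Finite F] in
theorem ncard_rhoDoubleCoset_trace (n r : ℕ) (β : F) :
    {w ∈ rhoDoubleCoset F n r | w.trace = β}.ncard =
      {w ∈ doubleCoset F n r | w.trace = -β}.ncard := by
  rw [← Set.ncard_image_of_injective {w ∈ doubleCoset F n r | w.trace = -β} neg_injective]
  congr 1
  ext w
  constructor
  · rintro ⟨h, h'⟩
    exact ⟨-w, ⟨(mem_rhoDoubleCoset_iff w).1 h, by rw [trace_neg, h']⟩, neg_neg w⟩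
  · rintro ⟨x, ⟨h, h'⟩, rfl⟩
    exact ⟨(mem_rhoDoubleCoset_iff _).2 (by rwa [neg_neg]), by rw [trace_neg, h', neg_neg]⟩

omit [Finite F] in
-- The change of variables `α ↦ -α` reverses the sign of the sum.
theorem delta_neg (m : ℕ) (γ : F) : delta m (-γ) = delta m γ := by
  refine Nat.card_congr ((Equiv.neg (Fin m → Fˣ)).subtypeEquiv fun α => ?_)
  simp only [Equiv.neg_apply, Pi.neg_apply, Units.val_neg, inv_neg, ← neg_add, sum_neg_distrib]
  exact neg_inj.symm.trans (by rw [neg_neg])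

end Formulas

section Final

variable {F : Type*} [Field F]

/-! ### The refined formula for odd `n` -/

/-- Completing the square: in characteristic 3 one has `-γ = 2γ`, so `x² - γx + 1 = (x + γ)² - (γ² -
1)`. The excluded value `x = 0` would give `γ² = γ² - 1`. -/
theorem delta_one_eq_card_sq (h3 : (3 : F) = 0) (γ : F) :
    delta 1 γ = Nat.card {y : F // y ^ 2 = γ ^ 2 - 1} := by
  have key : ∀ x : F, x ≠ 0 → (x + x⁻¹ = γ ↔ (x + γ) ^ 2 = γ ^ 2 - 1) := by
    intro x hx
    have h1 : x + x⁻¹ = γ ↔ x ^ 2 + 1 = γ * x := by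
      constructor
      · rintro rfl; field_simp
      · intro h; field_simp; rw [h]; ring
    rw [h1]
    constructor
    · intro h; linear_combination h + γ * x * h3
    · intro h; linear_combination h - γ * x * h3
  refine Nat.card_congr (Equiv.ofBijective (fun α => ⟨(α.1 0 : F) + γ, ?_⟩) ⟨?_, ?_⟩)
  · have h := α.2
    rw [Fin.sum_univ_one] at h
    exact (key _ (α.1 0).ne_zero).1 h
  · intro α α' h
    have h' : (α.1 0 : F) + γ = α'.1 0 + γ := congrArg Subtype.val h
    apply Subtype.ext
    funext i
    rw [Subsingleton.elim i 0]
    exact Units.ext (add_right_cancel h')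
  · rintro ⟨y, hy⟩
    have hx : y - γ ≠ 0 := by
      intro h
      rw [sub_eq_zero.1 h] at hy
      exact one_ne_zero (sub_eq_self.1 hy.symm)
    refine ⟨⟨fun _ => Units.mk0 _ hx, ?_⟩, Subtype.ext (by simp)⟩
    rw [Fin.sum_univ_one]
    exact (key _ hx).2 (by simpa using hy)

theorem card_sq_eq_zero : Nat.card {y : F // y ^ 2 = 0} = 1 := by
  rw [Nat.card_eq_one_iff_unique]
  refine ⟨⟨fun x y => Subtype.ext ?_⟩, ⟨⟨0, by simp⟩⟩⟩
  rw [pow_eq_zero_iff two_ne_zero |>.1 x.2, pow_eq_zero_iff two_ne_zero |>.1 y.2]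

theorem card_sq_eq_of_isSquare (h3 : (3 : F) = 0) {d : F} (hd : d ≠ 0) (hs : IsSquare d) :
    Nat.card {y : F // y ^ 2 = d} = 2 := by
  obtain ⟨z, rfl⟩ := hs
  have hz : z ≠ 0 := left_ne_zero_of_mul hd
  have hz' : z ≠ -z := by
    intro h
    have : 2 * z = 0 := by linear_combination h
    exact hz ((mul_eq_zero.1 this).resolve_left (two_ne_zero_of_three_eq_zero h3))
  have : {y : F | y ^ 2 = z * z} = {z, -z} := by
    ext y
    simp [← sq, sq_eq_sq_iff_eq_or_eq_neg]
  have h := Set.ncard_pair hz'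
  rw [← this] at h
  exact h

theorem card_sq_eq_of_not_isSquare {d : F} (hs : ¬ IsSquare d) :
    Nat.card {y : F // y ^ 2 = d} = 0 := by
  have : IsEmpty {y : F // y ^ 2 = d} := ⟨fun y => hs ⟨y.1, y.2.symm.trans (sq _)⟩⟩
  exact Nat.card_of_isEmpty

variable [Fintype F] [DecidableEq F]

theorem prod_eq_prod_by_disc (d : F → F) {z₀ z₁ : F} (hz : z₀ ≠ z₁)
    (hd : ∀ β, d β = 0 ↔ β = z₀ ∨ β = z₁) (f : F → ℕ) :
    ∏ β, f β = f z₀ * f z₁ * (∏ β with d β ≠ 0 ∧ IsSquare (d β), f β) *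
      ∏ β with ¬ IsSquare (d β), f β := by
  have h0 : ∏ β with d β = 0, f β = f z₀ * f z₁ := by
    rw [← prod_pair hz]
    congr 1
    ext β; simp [hd]
  rw [← h0, ← prod_filter_mul_prod_filter_not univ (fun β => IsSquare (d β)),
    ← prod_filter_mul_prod_filter_not (univ.filter fun β => IsSquare (d β)) (fun β => d β = 0),
    filter_filter, filter_filter]
  congr 3
  · ext β
    simp only [mem_filter, mem_univ, true_and, and_iff_right_iff_imp]
    intro h; rw [h]; exact IsSquare.zero
  · ext β; simp [and_comm]

omit [DecidableEq F] in
-- Integrality is shown for the constants themselves, since for `q = 3` no `β` has a nonzero square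
-- discriminant and `c₁` then is not a trace count. The bound `q ≤ b + 1` makes the entry for
-- nonsquares nonnegative; it is sharp for `m = 0`, where that entry is 0.
theorem exists_nat_Aminus_Bminus (m : ℕ) : ∃ a b : ℕ,
    (Nat.card F : ℚ)⁻¹ * Aminus (2 * m + 1) (Nat.card F) = a ∧
      Bminus (2 * m + 1) (Nat.card F) = b ∧ Nat.card F ≤ b + 1 := by
  set q := Nat.card F with hq
  have hq1 : 1 < q := Finite.one_lt_card
  have hq0 : (q : ℚ) ≠ 0 := Nat.cast_ne_zero.2 (by omega)
  have hq1' : (q : ℚ) - 1 ≠ 0 := by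
    rw [sub_ne_zero]; exact_mod_cast hq1.ne'
  have hc : ∀ k : ℕ, ((q ^ k - 1 : ℕ) : ℚ) = (q : ℚ) ^ k - 1 := fun k => by
    rw [Nat.cast_sub (Nat.one_le_pow _ _ (by omega))]; push_cast; rfl
  -- The factor `q⁻¹` lowers the exponent of `q` in `A⁻` by one, and the quotient in it is a
  -- geometric sum.
  refine ⟨q ^ (5 * m ^ 2 + 5 * m) * (∑ i ∈ range (2 * m + 1), q ^ i) *
    ∏ j ∈ Icc 1 m, (q ^ (2 * j - 1) - 1),
    q ^ (m ^ 2) * (q ^ (2 * m + 1) - 1) * ∏ j ∈ Icc 1 m, (q ^ (2 * j) - 1), ?_, ?_, ?_⟩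
  · have hg : ((q : ℚ) ^ (2 * m + 1) - 1) / ((q : ℚ) - 1) = ∑ i ∈ range (2 * m + 1), (q : ℚ) ^ i :=
      (geom_sum_eq (sub_ne_zero.1 hq1') _).symm
    rw [Aminus_eq, hg, Nat.cast_mul, Nat.cast_prod]
    simp only [hc]
    push_cast
    field_simp
    ring
  · rw [Bminus_eq, Nat.cast_mul, Nat.cast_mul, Nat.cast_prod]
    simp only [hc]
    push_cast
    rfl
  · have h1 : 1 ≤ q ^ (m ^ 2) := Nat.one_le_pow _ _ (by omega)
    have h2 : 1 ≤ ∏ j ∈ Icc 1 m, (q ^ (2 * j) - 1) := by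
      refine Nat.one_le_iff_ne_zero.2 (prod_ne_zero_iff.2 fun j hj => ?_)
      have := Nat.one_lt_pow (n := 2 * j) (by have := (mem_Icc.1 hj).1; omega) hq1
      omega
    have h3 : q ≤ q ^ (2 * m + 1) := Nat.le_self_pow (by omega) q
    have h4 : q ^ (2 * m + 1) - 1 ≤ q ^ (m ^ 2) * (q ^ (2 * m + 1) - 1) *
        ∏ j ∈ Icc 1 m, (q ^ (2 * j) - 1) := by
      calc q ^ (2 * m + 1) - 1 = 1 * (q ^ (2 * m + 1) - 1) * 1 := by ring
        _ ≤ _ := by gcongr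
    omega

/-- Here `γ` is the argument of `δ` and `d = γ² - 1` its discriminant, with zeros `z₀` and `z₁`. The
number of square roots of `d β`, namely 1, 2 or 0, selects the upper entry, and the statement serves
both sets for odd `n`. -/
theorem refined_weightDist_of_count [Algebra (ZMod 3) F] (m : ℕ) (D : Set (Mat F (2 * m + 1)))
    (γ d : F → F) {z₀ z₁ : F} (hz : z₀ ≠ z₁) (hd0 : ∀ β, d β = 0 ↔ β = z₀ ∨ β = z₁)
    (hd : ∀ β, γ β ^ 2 - 1 = d β)
    (hcount : ∀ β, ({w ∈ D | w.trace = β}.ncard : ℚ) =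
      (Nat.card F : ℚ)⁻¹ * Aminus (2 * m + 1) (Nat.card F) *
        (Bminus (2 * m + 1) (Nat.card F) + Nat.card F * (delta 1 (γ β) : ℚ) - Nat.card F + 1)) :
    ∃ (c : F → ℕ) (c₀ c₁ c₂ : ℕ),
      (∀ β, c β = {w ∈ D | w.trace = β}.ncard) ∧
      (∀ β, (c β : ℚ) = (Nat.card F : ℚ)⁻¹ * Aminus (2 * m + 1) (Nat.card F) *
        (Bminus (2 * m + 1) (Nat.card F) + Nat.card F * (delta 1 (γ β) : ℚ) - Nat.card F + 1)) ∧
      (c₀ : ℚ) = (Nat.card F : ℚ)⁻¹ * Aminus (2 * m + 1) (Nat.card F) *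
        (Bminus (2 * m + 1) (Nat.card F) + 1) ∧
      (c₁ : ℚ) = (Nat.card F : ℚ)⁻¹ * Aminus (2 * m + 1) (Nat.card F) *
        (Bminus (2 * m + 1) (Nat.card F) + Nat.card F + 1) ∧
      (c₂ : ℚ) = (Nat.card F : ℚ)⁻¹ * Aminus (2 * m + 1) (Nat.card F) *
        (Bminus (2 * m + 1) (Nat.card F) - Nat.card F + 1) ∧
      ∀ g : Fin D.ncard ≃ D, ∀ j ≤ D.ncard,
        weightDist (dcCode g) j = ∑ p ∈ pairs F j, ∏ β, trinom (c β) (p.1 β) (p.2 β) ∧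
        weightDist (dcCode g) j = ∑ p ∈ pairs F j,
          trinom c₀ (p.1 z₀) (p.2 z₀) * trinom c₀ (p.1 z₁) (p.2 z₁)
          * (∏ β with d β ≠ 0 ∧ IsSquare (d β), trinom c₁ (p.1 β) (p.2 β))
          * ∏ β with ¬ IsSquare (d β), trinom c₂ (p.1 β) (p.2 β) := by
  obtain ⟨a, b, ha, hb, hab⟩ := exists_nat_Aminus_Bminus (F := F) m
  rw [hb] at hcount ⊢
  simp only [ha] at hcount ⊢
  have h3 : (3 : F) = 0 := three_eq_zero
  have hδ : ∀ β, delta 1 (γ β) = Nat.card {y : F // y ^ 2 = d β} := fun β => by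
    rw [delta_one_eq_card_sq h3, hd]
  have hc₂ : ((a * (b + 1 - Nat.card F) : ℕ) : ℚ) = (a : ℚ) * (b - Nat.card F + 1) := by
    push_cast [Nat.cast_sub hab]; ring
  refine ⟨fun β => {w ∈ D | w.trace = β}.ncard, a * (b + 1), a * (b + Nat.card F + 1),
    a * (b + 1 - Nat.card F), fun _ => rfl, hcount, by push_cast; ring, by push_cast; ring, hc₂,
    fun g j _ => ⟨weightDist_dcCode g j, ?_⟩⟩
  rw [weightDist_dcCode]
  refine sum_congr rfl fun p _ => ?_
  have e₀ : ∀ β, d β = 0 → {w ∈ D | w.trace = β}.ncard = a * (b + 1) := by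
    intro β h
    have := hcount β
    rw [hδ, h, card_sq_eq_zero] at this
    have h' : ({w ∈ D | w.trace = β}.ncard : ℚ) = ((a * (b + 1) : ℕ) : ℚ) := by
      rw [this]; push_cast; ring
    exact_mod_cast h'
  have e₁ : ∀ β, d β ≠ 0 → IsSquare (d β) →
      {w ∈ D | w.trace = β}.ncard = a * (b + Nat.card F + 1) := by
    intro β h hs
    have := hcount β
    rw [hδ, card_sq_eq_of_isSquare h3 h hs] at this
    have h' : ({w ∈ D | w.trace = β}.ncard : ℚ) = ((a * (b + Nat.card F + 1) : ℕ) : ℚ) := by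
      rw [this]; push_cast; ring
    exact_mod_cast h'
  have e₂ : ∀ β, ¬ IsSquare (d β) →
      {w ∈ D | w.trace = β}.ncard = a * (b + 1 - Nat.card F) := by
    intro β hs
    have := hcount β
    rw [hδ, card_sq_eq_of_not_isSquare hs] at this
    have h' : ({w ∈ D | w.trace = β}.ncard : ℚ) = ((a * (b + 1 - Nat.card F) : ℕ) : ℚ) := by
      rw [this, hc₂]; push_cast; ring
    exact_mod_cast h'
  rw [prod_eq_prod_by_disc d hz hd0, e₀ z₀ ((hd0 _).2 (Or.inl rfl)),
    e₀ z₁ ((hd0 _).2 (Or.inr rfl))]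
  congr 1
  · congr 1
    refine prod_congr rfl fun β hβ => ?_
    rw [e₁ β (mem_filter.1 hβ).2.1 (mem_filter.1 hβ).2.2]
  · refine prod_congr rfl fun β hβ => ?_
    rw [e₂ β (mem_filter.1 hβ).2]

theorem weightDist_dcCode_split [Algebra (ZMod 3) F] {n : ℕ} {D : Set (Mat F n)} (z : F)
    (g : Fin D.ncard ≃ D) (j : ℕ) :
    weightDist (dcCode g) j = ∑ p ∈ pairs F j,
      trinom {w ∈ D | w.trace = z}.ncard (p.1 z) (p.2 z) *
        ∏ β with β ≠ z, trinom {w ∈ D | w.trace = β}.ncard (p.1 β) (p.2 β) := by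
  rw [weightDist_dcCode]
  refine sum_congr rfl fun p _ => ?_
  rw [← mul_prod_erase univ _ (mem_univ z)]
  congr 2
  ext β; simp

end Final

end TernaryDC

/-! ### Assembly of the four cases -/

theorem theorem5p3 {F : Type*} [Field F] [Fintype F] [DecidableEq F] [Algebra (ZMod 3) F]
    (q r : ℕ) (hr : 1 ≤ r) (hq : q = 3 ^ r) (hF : Fintype.card F = q) (n : ℕ) :
    -- part (1)
    (Odd n →
      ((dcMinus1 F n).ncard : ℚ) = Aminus n q * Bminus n q ∧
      ∃ (c : F → ℕ) (c₀ c₁ c₂ : ℕ),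
        (∀ β, c β = {w ∈ dcMinus1 F n | w.trace = β}.ncard) ∧
        (∀ β, (c β : ℚ) =
          (q : ℚ)⁻¹ * Aminus n q * (Bminus n q + q * (delta 1 (β - 1) : ℚ) - q + 1)) ∧
        (c₀ : ℚ) = (q : ℚ)⁻¹ * Aminus n q * (Bminus n q + 1) ∧
        (c₁ : ℚ) = (q : ℚ)⁻¹ * Aminus n q * (Bminus n q + q + 1) ∧
        (c₂ : ℚ) = (q : ℚ)⁻¹ * Aminus n q * (Bminus n q - q + 1) ∧
        ∀ g : Fin (dcMinus1 F n).ncard ≃ dcMinus1 F n, ∀ j ≤ (dcMinus1 F n).ncard,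
          weightDist (dcCode g) j = ∑ p ∈ pairs F j, ∏ β, trinom (c β) (p.1 β) (p.2 β) ∧
          weightDist (dcCode g) j = ∑ p ∈ pairs F j,
            trinom c₀ (p.1 0) (p.2 0) * trinom c₀ (p.1 2) (p.2 2)
            * (∏ β with β ^ 2 - 2 * β ≠ 0 ∧ IsSquare (β ^ 2 - 2 * β),
                trinom c₁ (p.1 β) (p.2 β))
            * ∏ β with ¬ IsSquare (β ^ 2 - 2 * β), trinom c₂ (p.1 β) (p.2 β)) ∧
    -- part (2)
    (Odd n →
      ((dcMinus2 F n).ncard : ℚ) = Aminus n q * Bminus n q ∧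
      ∃ (c : F → ℕ) (c₀ c₁ c₂ : ℕ),
        (∀ β, c β = {w ∈ dcMinus2 F n | w.trace = β}.ncard) ∧
        (∀ β, (c β : ℚ) =
          (q : ℚ)⁻¹ * Aminus n q * (Bminus n q + q * (delta 1 (β + 1) : ℚ) - q + 1)) ∧
        (c₀ : ℚ) = (q : ℚ)⁻¹ * Aminus n q * (Bminus n q + 1) ∧
        (c₁ : ℚ) = (q : ℚ)⁻¹ * Aminus n q * (Bminus n q + q + 1) ∧
        (c₂ : ℚ) = (q : ℚ)⁻¹ * Aminus n q * (Bminus n q - q + 1) ∧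
        ∀ g : Fin (dcMinus2 F n).ncard ≃ dcMinus2 F n, ∀ j ≤ (dcMinus2 F n).ncard,
          weightDist (dcCode g) j = ∑ p ∈ pairs F j, ∏ β, trinom (c β) (p.1 β) (p.2 β) ∧
          weightDist (dcCode g) j = ∑ p ∈ pairs F j,
            trinom c₀ (p.1 0) (p.2 0) * trinom c₀ (p.1 1) (p.2 1)
            * (∏ β with β ^ 2 + 2 * β ≠ 0 ∧ IsSquare (β ^ 2 + 2 * β),
                trinom c₁ (p.1 β) (p.2 β))
            * ∏ β with ¬ IsSquare (β ^ 2 + 2 * β), trinom c₂ (p.1 β) (p.2 β)) ∧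
    -- part (3)
    (Even n → 2 ≤ n →
      ((dcPlus1 F n).ncard : ℚ) = Aplus n q * Bplus n q ∧
      ∃ c : F → ℕ,
        (∀ β, c β = {w ∈ dcPlus1 F n | w.trace = β}.ncard) ∧
        (c 1 : ℚ) = (q : ℚ)⁻¹ * Aplus n q *
          (Bplus n q + q * (delta 2 (0 : F) : ℚ) + ((q : ℚ) - 1) ^ 3) ∧
        (∀ β, β ≠ 1 → (c β : ℚ) = (q : ℚ)⁻¹ * Aplus n q *
          (Bplus n q + q * (delta 2 (β - 1) : ℚ) - 2 * (q : ℚ) ^ 2 + 3 * q - 1)) ∧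
        ∀ g : Fin (dcPlus1 F n).ncard ≃ dcPlus1 F n, ∀ j ≤ (dcPlus1 F n).ncard,
          weightDist (dcCode g) j = ∑ p ∈ pairs F j,
            trinom (c 1) (p.1 1) (p.2 1) * ∏ β with β ≠ 1, trinom (c β) (p.1 β) (p.2 β)) ∧
    -- part (4)
    (Even n → 2 ≤ n →
      ((dcPlus2 F n).ncard : ℚ) = Aplus n q * Bplus n q ∧
      ∃ c : F → ℕ,
        (∀ β, c β = {w ∈ dcPlus2 F n | w.trace = β}.ncard) ∧
        (c (-1) : ℚ) = (q : ℚ)⁻¹ * Aplus n q *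
          (Bplus n q + q * (delta 2 (0 : F) : ℚ) + ((q : ℚ) - 1) ^ 3) ∧
        (∀ β, β ≠ -1 → (c β : ℚ) = (q : ℚ)⁻¹ * Aplus n q *
          (Bplus n q + q * (delta 2 (β + 1) : ℚ) - 2 * (q : ℚ) ^ 2 + 3 * q - 1)) ∧
        ∀ g : Fin (dcPlus2 F n).ncard ≃ dcPlus2 F n, ∀ j ≤ (dcPlus2 F n).ncard,
          weightDist (dcCode g) j = ∑ p ∈ pairs F j,
            trinom (c (-1)) (p.1 (-1)) (p.2 (-1))
            * ∏ β with β ≠ -1, trinom (c β) (p.1 β) (p.2 β)) := by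
  have hF' : Nat.card F = q := by rw [Nat.card_eq_fintype_card, hF]
  clear hq hF
  subst hF'
  have h3 : (3 : F) = 0 := three_eq_zero
  refine ⟨?_, ?_, ?_, ?_⟩
  · rintro ⟨m, rfl⟩
    refine ⟨ncard_doubleCoset_minus h3 m, ?_⟩
    refine refined_weightDist_of_count m _ (fun β => β - 1) (fun β => β ^ 2 - 2 * β)
      (two_ne_zero_of_three_eq_zero h3).symm (fun β => ?_) (fun β => ?_)
      (ncard_doubleCoset_minus_trace h3 m)
    · rw [sq, ← sub_mul, mul_eq_zero, sub_eq_zero, or_comm]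
    · ring
  · rintro ⟨m, rfl⟩
    refine ⟨(congrArg _ (ncard_rhoDoubleCoset _ _)).trans (ncard_doubleCoset_minus h3 m), ?_⟩
    refine refined_weightDist_of_count m _ (fun β => β + 1) (fun β => β ^ 2 + 2 * β)
      zero_ne_one (fun β => ?_) (fun β => ?_) (fun β => ?_)
    · have h2 : β + 2 = β - 1 := by linear_combination h3
      rw [sq, ← add_mul, h2, mul_eq_zero, sub_eq_zero, or_comm]
    · ring
    · have h := ncard_doubleCoset_minus_trace h3 m (-β)
      rw [← ncard_rhoDoubleCoset_trace, show -β - 1 = -(β + 1) by ring, delta_neg] at h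
      exact h
  · intro hn hn2
    obtain ⟨m, rfl⟩ : ∃ m, n = 2 * m + 2 := by
      obtain ⟨k, rfl⟩ := hn
      exact ⟨k - 1, by omega⟩
    refine ⟨ncard_doubleCoset_plus h3 m, fun β => {w ∈ dcPlus1 F (2 * m + 2) | w.trace = β}.ncard,
      fun _ => rfl, ?_, fun β hβ => ?_, fun g j _ => weightDist_dcCode_split 1 g j⟩
    · refine (ncard_doubleCoset_plus_trace h3 m 1).trans ?_
      rw [if_pos rfl, sub_self]
    · refine (ncard_doubleCoset_plus_trace h3 m β).trans ?_
      rw [if_neg hβ]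
      ring
  · intro hn hn2
    obtain ⟨m, rfl⟩ : ∃ m, n = 2 * m + 2 := by
      obtain ⟨k, rfl⟩ := hn
      exact ⟨k - 1, by omega⟩
    have key : ∀ β, {w ∈ dcPlus2 F (2 * m + 2) | w.trace = β}.ncard =
        {w ∈ doubleCoset F (2 * m + 2) (2 * m) | w.trace = -β}.ncard :=
      ncard_rhoDoubleCoset_trace _ _
    refine ⟨(congrArg _ (ncard_rhoDoubleCoset _ _)).trans (ncard_doubleCoset_plus h3 m),
      fun β => {w ∈ dcPlus2 F (2 * m + 2) | w.trace = β}.ncard,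
      fun _ => rfl, ?_, fun β hβ => ?_, fun g j _ => weightDist_dcCode_split (-1) g j⟩
    · simp only [key]
      rw [ncard_doubleCoset_plus_trace h3 m, neg_neg, if_pos rfl, sub_self]
    · simp only [key]
      rw [ncard_doubleCoset_plus_trace h3 m, if_neg fun h => hβ (by rw [← h, neg_neg]),
        show -β - 1 = -(β + 1) by ring, delta_neg]
      ring
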